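/- Let $f$ be a meromorphic function on $\mathbb{C}$, let $n\ge 1$, and let $\omega,\varphi$ be complex polynomials of degree $n$ with the same leading coefficient $c\neq 0$. Let $q\ge 2$ and let $a_1,\dots,a_q\in\mathbb{C}$ be distinct. Denote by $m(r,\cdot)$, $N(r,\cdot)$ and $T(r,\cdot)=m(r,\cdot)+N(r,\cdot)$ the Nevanlinna proximity, (integrated, with multiplicities) counting and characteristic functions. Suppose that $f\circ\omega\not\equiv f\circ\varphi$ and that the hyper-order of $f$ satisfies $$\varsigma(f):=\limsup_{r\to\infty}\frac{\log\log T(r,f)}{\log r}<\frac1{n^2}.$$ Then there is a set $E\subset(0,\infty)$ of finite logarithmic measure, i.e. $\int_{E\cap[1,\infty)}\frac{dt}{t}<\infty$, such that $$m(r,f\circ\varphi)+\sum_{k=1}^q m\Big(r,\frac1{f\circ\varphi-a_k}\Big)\le 2T(r,f\circ\varphi)-N_\omega(r,f\circ\varphi)+o\big(T(r,f\circ\varphi)\big)$$ for $r\notin E$, where the error term is understood as $r\to\infty$ outside $E$, and $$N_\omega(r,f\circ\varphi):=2N(r,f\circ\varphi)-N(r,f\circ\omega-f\circ\varphi)+N\Big(r,\frac1{f\circ\omega-f\circ\varphi}\Big).$$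 -/

import Mathlib

open Filter Set MeasureTheory Asymptotics Polynomial ValueDistribution

/-- The hyper-order `limsup_{r → ∞} log log T(r, f) / log r` of a meromorphic function `f`, where
`T(r, f)` is the Nevanlinna characteristic. The upper limit is taken in the extended reals, so that
it has no junk value when the quotient is unbounded. -/
noncomputable def hyperOrder (f : ℂ → ℂ) : EReal :=
  limsup (fun r : ℝ ↦
    ((Real.log (Real.log (characteristic f ⊤ r)) / Real.log r : ℝ) : EReal)) atTop

/-- The set `E` is measurable and has finite logarithmic measure:
`∫_{E ∩ [1, ∞)} dt / t < ∞`. -/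
def HasFiniteLogMeasure (E : Set ℝ) : Prop :=
  MeasurableSet E ∧ ∫⁻ t in E ∩ Ici 1, ENNReal.ofReal (1 / t) < ⊤

/-- The counting term
`N_ω(r, f∘φ) = 2 N(r, f∘φ) - N(r, f∘ω - f∘φ) + N(r, 1 / (f∘ω - f∘φ))`.
Here `N(r, g)`, the integrated counting function of the poles of `g` with multiplicity, is
`logCounting g ⊤ r`. -/
noncomputable def compositeCounting (f : ℂ → ℂ) (ω φ : ℂ[X]) (r : ℝ) : ℝ :=
  2 * logCounting (fun z ↦ f (φ.eval z)) ⊤ r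
    - logCounting (fun z ↦ f (ω.eval z) - f (φ.eval z)) ⊤ r
    + logCounting (fun z ↦ 1 / (f (ω.eval z) - f (φ.eval z))) ⊤ r

/-!
# A second main theorem for compositions with polynomials

Write `F = f ∘ φ`, `G = f ∘ ω` and `Δ = G - F`. Off the zeros of `Δ` and of the `F - a k`,
`∑ k, 1 / (F - a k) = (1 / Δ) * ∑ k, ((G - a k) / (F - a k) - 1)`, and `F` is close to at most one
of the `a k` at a time. Hence `∑ k, m(r, 1 / (F - a k))` is at most
`m(r, 1 / Δ) + ∑ k, m(r, (G - a k) / (F - a k)) + O(1)`. The first main theorem turns `m(r, 1 / Δ)`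
into `m(r, Δ) + N(r, Δ) - N(r, 1 / Δ) + O(1)`, and `m(r, Δ) ≤ m(r, F) + m(r, G / F) + O(1)`. This
is the asserted inequality, with the proximity functions of the quotients `(G - b) / (F - b)` as
error terms (`exists_proximity_add_sum_proximity_le`).

Each of these error terms is small by an analogue of the lemma on the logarithmic derivative. For
`g = f - b`, the Poisson–Jensen formula in a disc of radius `R` somewhat larger than `max ‖φ‖` is
applied at the two points `φ z` and `ω z`, which are at distance `s = O(r ^ (n - 1))` because the
leading terms of `φ` and `ω` cancel (`proximity_comp_div_comp_le`).
* The Poisson integral changes by a factor `1 + O(s / d)`, `d` being the distance to the boundary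
  circle, and its mean over `‖z‖ = r` is its value at `φ 0`, since it is harmonic in `z`.
* A Blaschke factor with zero `i` changes its logarithm by at most a constant times
  `s ^ α * ‖φ z - i‖ ^ (-α)` and three similar terms. Circle means of `‖p z - i‖ ^ (-α)` are
  `O(r ^ (-n α))` uniformly in `i` when `n α < 1`
  (`Polynomial.circleAverage_norm_eval_sub_rpow_neg_le`).

With `d` of order `r ^ (n - μ)`, where `μ < α < 1 / n`, this gives
`m(r, (G - b) / (F - b)) = O(r ^ (μ - α) * (T(R', f) + 1))` with
`R' = ‖c‖ * (r + r ^ (1 - μ)) ^ n - ‖φ 0‖` (`exists_proximity_comp_div_comp_le`).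

It remains to bound `T(R', f)` by a multiple of `T(r, F)`. The hyper-order hypothesis gives
`log T(x, f) ≤ x ^ l` with `l < 1 / n ^ 2`, so, as a function of `r`, the logarithm of
`V r = T(‖c‖ * r ^ n - ‖φ 0‖, f)` is `O(r ^ (n l))` with `n l < 1 / n`, and `μ` can be chosen above
`n l`. A growth lemma then yields `V (r + r ^ (1 - μ)) ≤ 2 * V r` outside a set of finite
logarithmic measure (`hasFiniteLogMeasure_setOf_two_mul_lt`). Finally `V r ≤ 2 * T(r, F) + O(1)`
(`characteristic_le_two_mul_characteristic_comp`), by Jensen's formula for the polynomials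
`φ - b` and Cartan's formula for the characteristic.
-/

/-! ### Polynomial maps -/

theorem Polynomial.exists_eval_sub_eq_prod (p : ℂ[X]) (hp : 1 ≤ p.natDegree) (b : ℂ) :
    ∃ u : Fin p.natDegree → ℂ, ∀ z, p.eval z - b = p.leadingCoeff * ∏ i, (z - u i) := by
  have hdeg : (p - C b).natDegree = p.natDegree := natDegree_sub_C
  have hlc : (p - C b).leadingCoeff = p.leadingCoeff :=
    leadingCoeff_sub_of_degree_lt
      (degree_C_le.trans_lt (natDegree_pos_iff_degree_pos.1 hp))
  have hcard : (p - C b).roots.toList.length = p.natDegree := by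
    rw [Multiset.length_toList, ← hdeg]
    exact (IsAlgClosed.splits _).natDegree_eq_card_roots.symm
  rw [← hcard]
  refine ⟨fun i ↦ (p - C b).roots.toList.get i, fun z ↦ ?_⟩
  have := (IsAlgClosed.splits (p - C b)).eval_eq_prod_roots z
  rw [hlc, eval_sub, eval_C] at this
  simp only [List.get_eq_getElem]
  rw [this, Fin.prod_univ_fun_getElem _ (fun w ↦ z - w), ← Multiset.prod_coe, ← Multiset.map_coe,
    Multiset.coe_toList]

theorem Polynomial.not_eventuallyConst_eval (p : ℂ[X]) (hp : 1 ≤ p.natDegree) (u : ℂ) :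
    ¬ EventuallyConst (fun z ↦ p.eval z) (nhds u) := by
  intro h
  obtain ⟨c, hc⟩ := eventuallyConst_iff_exists_eventuallyEq.1 h
  have h1 : (p - C c) = 0 := by
    refine Polynomial.eq_zero_of_infinite_isRoot _ ?_
    have : {z | p.eval z = c} ∈ nhds u := hc
    refine (infinite_of_mem_nhds u this).mono ?_
    intro z (hz : p.eval z = c)
    simp [hz]
  rw [sub_eq_zero] at h1
  rw [h1] at hp
  simp at hp

theorem Meromorphic.comp_eval {g : ℂ → ℂ} (hg : Meromorphic g) (p : ℂ[X]) :
    Meromorphic fun z ↦ g (p.eval z) := fun z ↦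
  (hg _).comp_analyticAt (p.differentiable.analyticAt z)

theorem Polynomial.preimage_eval_mem_codiscrete {p : ℂ[X]} (hp : 1 ≤ p.natDegree) {s : Set ℂ}
    (hs : s ∈ codiscrete ℂ) : (fun z ↦ p.eval z) ⁻¹' s ∈ codiscrete ℂ :=
  AnalyticOnNhd.preimage_mem_codiscreteWithin (U := univ) (f := fun z ↦ p.eval z)
    (fun z _ ↦ p.differentiable.analyticAt z)
    (fun x _ hx ↦ (p.not_eventuallyConst_eval hp x hx).elim)
    (codiscreteWithin_mono (subset_univ _) hs)

theorem Polynomial.exists_norm_eval_le (p : ℂ[X]) {m : ℕ} (hm : p.natDegree ≤ m) :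
    ∃ K : ℝ, 0 ≤ K ∧ ∀ r : ℝ, 1 ≤ r → ∀ z : ℂ, ‖z‖ ≤ r → ‖p.eval z‖ ≤ K * r ^ m := by
  refine ⟨∑ i ∈ Finset.range (p.natDegree + 1), ‖p.coeff i‖,
    Finset.sum_nonneg fun _ _ ↦ norm_nonneg _, fun r hr z hz ↦ ?_⟩
  rw [eval_eq_sum_range, Finset.sum_mul]
  refine norm_sum_le_of_le _ fun i hi ↦ ?_
  rw [norm_mul, norm_pow]
  have hi' : i ≤ m := by
    have := Finset.mem_range.1 hi
    lia
  gcongr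
  exact (pow_le_pow_left₀ (norm_nonneg _) hz i).trans (pow_le_pow_right₀ hr hi')

theorem Polynomial.natDegree_sub_le_sub_one {p p' : ℂ[X]} {n : ℕ} (hn : 1 ≤ n)
    (hp : p.natDegree = n) (hp' : p'.natDegree = n) (hc : p.leadingCoeff = p'.leadingCoeff) :
    (p - p').natDegree ≤ n - 1 := by
  rw [natDegree_le_iff_coeff_eq_zero]
  intro N hN
  rw [coeff_sub]
  rcases (show n ≤ N by lia).eq_or_lt with h | h
  · rw [← h, sub_eq_zero]
    simpa [leadingCoeff, hp, hp'] using hc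
  · rw [coeff_eq_zero_of_natDegree_lt (by lia), coeff_eq_zero_of_natDegree_lt (by lia), sub_zero]

/-! ### Circle averages of negative powers -/

theorem intervalIntegrable_abs_sin_rpow_neg {β : ℝ} (hβ : 0 < β) (hβ1 : β < 1) (a b : ℝ) :
    IntervalIntegrable (fun θ ↦ |Real.sin θ| ^ (-β)) volume a b := by
  have hmeas : Measurable (fun θ : ℝ ↦ |Real.sin θ| ^ (-β)) := by fun_prop
  have h1 : IntervalIntegrable (fun θ ↦ |Real.sin θ| ^ (-β)) volume 0 (Real.pi / 2) := by
    have h0 : IntervalIntegrable (fun θ : ℝ ↦ (2 / Real.pi) ^ (-β) * θ ^ (-β)) volume 0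
        (Real.pi / 2) :=
      (intervalIntegral.intervalIntegrable_rpow' (by linarith)).const_mul _
    refine h0.mono_fun' hmeas.aestronglyMeasurable ?_
    filter_upwards [ae_restrict_mem measurableSet_uIoc] with θ hθ
    rw [uIoc_of_le (by positivity)] at hθ
    have h2 := Real.mul_le_sin hθ.1.le hθ.2
    have h3 : 0 < 2 / Real.pi * θ := mul_pos (by positivity) hθ.1
    rw [Real.norm_of_nonneg (by positivity), ← Real.mul_rpow (by positivity) hθ.1.le]
    exact Real.rpow_le_rpow_of_nonpos h3 (h2.trans (le_abs_self _)) (by linarith)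
  have h2 : IntervalIntegrable (fun θ ↦ |Real.sin θ| ^ (-β)) volume (Real.pi / 2) Real.pi := by
    have := h1.comp_sub_left Real.pi
    simp only [Real.sin_pi_sub, sub_zero] at this
    rw [show Real.pi - Real.pi / 2 = Real.pi / 2 by ring] at this
    exact this.symm
  have hper : Function.Periodic (fun θ ↦ |Real.sin θ| ^ (-β)) Real.pi := by
    intro θ
    simp [Real.sin_add_pi]
  exact hper.intervalIntegrable Real.pi_ne_zero (t := 0) (by simpa using h1.trans h2) a b

/-- The distance from `ζ` to a point of the circle is at least the distance from that point to the
line through `0` and `ζ`. -/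
theorem mul_abs_sin_sub_arg_le_norm_circleMap_sub {r : ℝ} (hr : 0 < r) (ζ : ℂ) (θ : ℝ) :
    r * |Real.sin (θ - ζ.arg)| ≤ ‖circleMap 0 r θ - ζ‖ := by
  have h : (circleMap 0 r θ - ζ) * Complex.exp (-(ζ.arg : ℂ) * Complex.I) =
      r * Complex.exp ((θ - ζ.arg : ℝ) * Complex.I) - ‖ζ‖ := by
    conv_lhs => rw [← Complex.norm_mul_exp_arg_mul_I ζ]
    simp only [circleMap, zero_add, sub_mul, mul_assoc, ← Complex.exp_add]
    simp only [Complex.norm_mul_exp_arg_mul_I]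
    push_cast
    ring_nf
    simp
  calc r * |Real.sin (θ - ζ.arg)|
      = |((circleMap 0 r θ - ζ) * Complex.exp (-(ζ.arg : ℂ) * Complex.I)).im| := by
        rw [h]
        simp [Complex.exp_im, abs_mul, abs_of_pos hr, Complex.mul_im,
          Complex.exp_ofReal_mul_I_re, -Complex.ofReal_sub]
    _ ≤ ‖(circleMap 0 r θ - ζ) * Complex.exp (-(ζ.arg : ℂ) * Complex.I)‖ :=
        Complex.abs_im_le_norm _
    _ = ‖circleMap 0 r θ - ζ‖ := by
        rw [norm_mul, ← Complex.ofReal_neg, Complex.norm_exp_ofReal_mul_I, mul_one]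

/-- The constant does not depend on the position of `ζ`, which may lie on the circle itself. -/
theorem circleAverage_norm_sub_rpow_neg_le {β : ℝ} (hβ : 0 < β) (hβ1 : β < 1) :
    ∃ C : ℝ, 0 ≤ C ∧ ∀ (ζ : ℂ) (r : ℝ), 0 < r →
      CircleIntegrable (fun z ↦ ‖z - ζ‖ ^ (-β)) 0 r ∧
      Real.circleAverage (fun z ↦ ‖z - ζ‖ ^ (-β)) 0 r ≤ C * r ^ (-β) := by
  refine ⟨(2 * Real.pi)⁻¹ * ∫ θ in (0)..(2 * Real.pi), |Real.sin θ| ^ (-β), ?_, ?_⟩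
  · refine mul_nonneg (by positivity) (intervalIntegral.integral_nonneg (by positivity) ?_)
    intro θ _
    positivity
  intro ζ r hr
  set τ := ζ.arg
  have hint : IntervalIntegrable (fun θ ↦ r ^ (-β) * |Real.sin (θ - τ)| ^ (-β)) volume 0
      (2 * Real.pi) := by
    have := (intervalIntegrable_abs_sin_rpow_neg hβ hβ1 (0 - τ) (2 * Real.pi - τ)).comp_sub_right τ
    simp only [sub_add_cancel] at this
    exact this.const_mul _
  have hae : ∀ᵐ θ : ℝ, ‖circleMap 0 r θ - ζ‖ ^ (-β) ≤ r ^ (-β) * |Real.sin (θ - τ)| ^ (-β) := by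
    have hc : ({θ : ℝ | Real.sin (θ - τ) = 0} : Set ℝ).Countable := by
      have : {θ : ℝ | Real.sin (θ - τ) = 0} ⊆ range (fun k : ℤ ↦ k * Real.pi + τ) := by
        intro θ hθ
        obtain ⟨k, hk⟩ := Real.sin_eq_zero_iff.1 hθ
        exact ⟨k, by simp only; linarith⟩
      exact (countable_range _).mono this
    filter_upwards [hc.ae_notMem volume] with θ hθ
    have hθ' : 0 < |Real.sin (θ - τ)| := abs_pos.2 hθ
    rw [← Real.mul_rpow hr.le hθ'.le]
    exact Real.rpow_le_rpow_of_nonpos (by positivity)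
      (mul_abs_sin_sub_arg_le_norm_circleMap_sub hr ζ θ) (by linarith)
  have hci : CircleIntegrable (fun z ↦ ‖z - ζ‖ ^ (-β)) 0 r := by
    refine hint.mono_fun' (Measurable.aestronglyMeasurable ?_) ?_
    · have := measurable_circleMap 0 r
      fun_prop
    · filter_upwards [ae_restrict_of_ae hae] with θ hθ
      rwa [Real.norm_of_nonneg (by positivity)]
  refine ⟨hci, ?_⟩
  have hper : Function.Periodic (fun θ ↦ |Real.sin θ| ^ (-β)) (2 * Real.pi) := by
    intro θ
    simp
  rw [Real.circleAverage_def, smul_eq_mul, mul_assoc]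
  refine mul_le_mul_of_nonneg_left ?_ (by positivity)
  calc ∫ θ in (0)..(2 * Real.pi), ‖circleMap 0 r θ - ζ‖ ^ (-β)
      ≤ ∫ θ in (0)..(2 * Real.pi), r ^ (-β) * |Real.sin (θ - τ)| ^ (-β) :=
        intervalIntegral.integral_mono_ae (by positivity) hci hint hae
    _ = r ^ (-β) * ∫ θ in (0)..(2 * Real.pi), |Real.sin (θ - τ)| ^ (-β) :=
        intervalIntegral.integral_const_mul _ _
    _ = r ^ (-β) * ∫ θ in (0)..(2 * Real.pi), |Real.sin θ| ^ (-β) := by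
        rw [intervalIntegral.integral_comp_sub_right (fun θ ↦ |Real.sin θ| ^ (-β)) τ]
        have := hper.intervalIntegral_add_eq (0 - τ) 0
        rw [zero_add, show 0 - τ + 2 * Real.pi = 2 * Real.pi - τ by ring] at this
        rw [this]
    _ = _ := mul_comm _ _

theorem circleAverage_const_mul (a : ℝ) (f : ℂ → ℝ) (c : ℂ) (R : ℝ) :
    Real.circleAverage (fun z ↦ a * f z) c R = a * Real.circleAverage f c R :=
  Real.circleAverage_fun_smul (a := a) (f := f)

/-- Circle means of `‖p z - b‖ ^ (-α)` are `O(r ^ (-n α))` uniformly in `b`, where `n` is the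
degree of `p` and `n α < 1`. The weighted inequality between geometric and arithmetic means
reduces this to the linear factors of `p - b`, each raised to the power `-n α`. -/
theorem Polynomial.circleAverage_norm_eval_sub_rpow_neg_le (p : ℂ[X]) (hp : 1 ≤ p.natDegree)
    {α : ℝ} (hα : 0 < α) (hα1 : p.natDegree * α < 1) :
    ∃ M : ℝ, 0 ≤ M ∧ ∀ (b : ℂ) (r : ℝ), 0 < r →
      CircleIntegrable (fun z ↦ ‖p.eval z - b‖ ^ (-α)) 0 r ∧
      Real.circleAverage (fun z ↦ ‖p.eval z - b‖ ^ (-α)) 0 r ≤ M * r ^ (-(p.natDegree * α)) := by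
  have hn : (0 : ℝ) < p.natDegree := by exact_mod_cast hp
  obtain ⟨C, hC0, hC⟩ := circleAverage_norm_sub_rpow_neg_le (β := p.natDegree * α)
    (by positivity) hα1
  refine ⟨‖p.leadingCoeff‖ ^ (-α) * C, by positivity, fun b r hr ↦ ?_⟩
  obtain ⟨u, hu⟩ := p.exists_eval_sub_eq_prod hp b
  set B : ℂ → ℝ := fun z ↦ ∑ i, (‖p.leadingCoeff‖ ^ (-α) * (p.natDegree : ℝ)⁻¹) *
    ‖z - u i‖ ^ (-(p.natDegree * α)) with hB
  have hle : ∀ z, ‖p.eval z - b‖ ^ (-α) ≤ B z := by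
    intro z
    rw [hu z, norm_mul, norm_prod, Real.mul_rpow (by positivity) (by positivity), hB]
    simp only [mul_assoc]
    rw [← Finset.mul_sum]
    refine mul_le_mul_of_nonneg_left ?_ (by positivity)
    rw [← Real.finsetProd_rpow _ _ (by intros; positivity)]
    have := Real.geom_mean_le_arith_mean_weighted (Finset.univ : Finset (Fin p.natDegree))
      (fun _ ↦ (p.natDegree : ℝ)⁻¹) (fun i ↦ ‖z - u i‖ ^ (-(p.natDegree * α)))
      (by intros; positivity) (by simp [hn.ne']) (by intros; positivity)
    refine le_trans (le_of_eq ?_) this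
    refine Finset.prod_congr rfl fun i _ ↦ ?_
    rw [← Real.rpow_mul (norm_nonneg _)]
    congr 1
    field_simp
  have hBi : ∀ i ∈ Finset.univ, CircleIntegrable (fun z ↦
      (‖p.leadingCoeff‖ ^ (-α) * (p.natDegree : ℝ)⁻¹) * ‖z - u i‖ ^ (-(p.natDegree * α))) 0 r :=
    fun i _ ↦ (hC (u i) r hr).1.const_mul _
  have hBint : CircleIntegrable B 0 r := CircleIntegrable.fun_sum _ hBi
  have hci : CircleIntegrable (fun z ↦ ‖p.eval z - b‖ ^ (-α)) 0 r := by
    refine IntervalIntegrable.mono_fun' hBint (Measurable.aestronglyMeasurable ?_) ?_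
    · have h1 := measurable_circleMap 0 r
      have h2 : Measurable (fun z : ℂ ↦ p.eval z) := p.continuous.measurable
      have := h2.comp h1
      simp only [Function.comp_def] at this
      fun_prop
    · filter_upwards with θ
      rw [Real.norm_of_nonneg (by positivity)]
      exact hle _
  refine ⟨hci, (Real.circleAverage_mono hci hBint fun z _ ↦ hle z).trans ?_⟩
  rw [hB, Real.circleAverage_fun_sum hBi]
  calc _ ≤ ∑ _i : Fin p.natDegree, (‖p.leadingCoeff‖ ^ (-α) * (p.natDegree : ℝ)⁻¹) *
        (C * r ^ (-(p.natDegree * α))) := by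
        refine Finset.sum_le_sum fun i _ ↦ ?_
        rw [circleAverage_const_mul]
        exact mul_le_mul_of_nonneg_left (hC (u i) r hr).2 (by positivity)
    _ = _ := by
        simp only [Finset.sum_const, Finset.card_univ, Fintype.card_fin, nsmul_eq_mul]
        field_simp

/-! ### The Poisson–Jensen formula -/

theorem Meromorphic.codiscrete_setOf_analyticAt_and_ne_zero {g : ℂ → ℂ} (hg : Meromorphic g)
    (hg' : ∀ u, meromorphicOrderAt g u ≠ ⊤) :
    {z | AnalyticAt ℂ g z ∧ g z ≠ 0} ∈ codiscrete ℂ := by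
  have h1 := MeromorphicOn.analyticAt_mem_codiscreteWithin (hg.meromorphicOn (s := univ))
  have h2 := MeromorphicOn.eventually_codiscreteWithin_apply_ne_zero
    (hg.meromorphicOn (s := univ)) fun x _ ↦ hg' x
  filter_upwards [h1, h2] with z hz1 hz2 using ⟨hz1, hz2⟩

theorem continuousOn_poissonKernel_sphere {R : ℝ} {w : ℂ} (hw : w ∈ Metric.ball 0 R) :
    ContinuousOn (poissonKernel 0 w) (Metric.sphere 0 |R|) := by
  rw [poissonKernel_eq_re_herglotzRieszKernel]
  exact Complex.continuous_re.comp_continuousOn (continuousOn_herglotzRieszKernel_sphere hw)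

theorem circleIntegrable_poissonKernel_mul {R : ℝ} {w : ℂ} (hw : w ∈ Metric.ball 0 R)
    {v : ℂ → ℝ} (hv : CircleIntegrable v 0 R) :
    CircleIntegrable (fun ζ ↦ poissonKernel 0 w ζ * v ζ) 0 R :=
  hv.continuousOn_mul (continuousOn_poissonKernel_sphere hw)

theorem circleAverage_poissonKernel_mul_log_norm_sub {R : ℝ} {w ρ : ℂ} (hw : w ∈ Metric.ball 0 R)
    (hρ : ρ ∈ Metric.sphere 0 R) :
    Real.circleAverage (fun ζ ↦ poissonKernel 0 w ζ * Real.log ‖ζ - ρ‖) 0 R =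
      Real.log ‖w - ρ‖ := by
  rw [← circleAverage_re_herglotzRieszKernel_mul_log hρ hw,
    ← poissonKernel_eq_re_herglotzRieszKernel]
  rfl

open MeromorphicOn in
/-- The **Poisson–Jensen formula**. The sum runs over the zeros and poles in the open disc; those
on the boundary circle are absorbed in the Poisson integral. -/
theorem Meromorphic.log_norm_eq_circleAverage_poissonKernel_sub {g : ℂ → ℂ} (hg : Meromorphic g)
    (hg' : ∀ u, meromorphicOrderAt g u ≠ ⊤) {R : ℝ} (hR : 0 < R) {w : ℂ}
    (hw : w ∈ Metric.ball 0 R) (hgw : AnalyticAt ℂ g w) (hgw' : g w ≠ 0) :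
    Real.log ‖g w‖ = Real.circleAverage (fun ζ ↦ poissonKernel 0 w ζ * Real.log ‖g ζ‖) 0 R
      - ∑ᶠ i, divisor g (Metric.ball 0 R) i * Real.log ‖Complex.canonicalFactor R i w‖ := by
  obtain ⟨h, D⟩ := (hg.meromorphicOn (s := Metric.closedBall 0 R)).exists_ecanonicalDecomp
    fun u ↦ hg' u
  -- `h` is `g` with its zeros and poles in the closed disc divided out, by Blaschke factors in the
  -- open disc and by linear factors on the circle. So `log ‖h‖` is harmonic.
  have key : ∀ z ∈ Metric.closedBall (0 : ℂ) R, AnalyticAt ℂ g z → g z ≠ 0 →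
      Real.log ‖h z‖ = (∑ᶠ i, divisor g (Metric.ball 0 R) i *
        Real.log ‖Complex.canonicalFactor R i z‖)
        - (∑ᶠ i, divisor g (Metric.sphere 0 R) i * Real.log ‖z - i‖) + Real.log ‖g z‖ := by
    intro z hz h1 h2
    rw [D.log_norm_eq hz (h1.meromorphicNFAt.meromorphicOrderAt_eq_zero_iff.2 h2) hR,
      h1.meromorphicTrailingCoeffAt_of_ne_zero h2]
  have hfin : (divisor g (Metric.sphere 0 R)).support.Finite :=
    (divisor g (Metric.sphere 0 R)).finiteSupport (isCompact_sphere 0 R)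
  have hsum : ∀ z : ℂ, ∑ᶠ i, divisor g (Metric.sphere 0 R) i * Real.log ‖z - i‖ =
      ∑ i ∈ hfin.toFinset, divisor g (Metric.sphere 0 R) i * Real.log ‖z - i‖ := by
    intro z
    refine finsum_eq_sum_of_support_subset _ fun i hi ↦ ?_
    have : divisor g (Metric.sphere 0 R) i ≠ 0 := by
      intro h0
      simp [h0] at hi
    simpa using this
  have hharm : Real.circleAverage (fun ζ ↦ poissonKernel 0 w ζ * Real.log ‖h ζ‖) 0 R =
      Real.log ‖h w‖ := by
    have : InnerProductSpace.HarmonicOnNhd (fun z ↦ Real.log ‖h z‖) (Metric.closedBall 0 R) :=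
      fun x hx ↦ (D.analyticOnNhd x hx).harmonicAt_log_norm (D.ne_zero x hx)
    exact this.circleAverage_poissonKernel_smul hw
  have hcod : (fun ζ ↦ poissonKernel 0 w ζ * Real.log ‖h ζ‖)
      =ᶠ[codiscreteWithin (Metric.sphere 0 |R|)]
      fun ζ ↦ poissonKernel 0 w ζ * Real.log ‖g ζ‖ - ∑ i ∈ hfin.toFinset,
        divisor g (Metric.sphere 0 R) i * (poissonKernel 0 w ζ * Real.log ‖ζ - i‖) := by
    have h1 : {z | AnalyticAt ℂ g z ∧ g z ≠ 0} ∈ codiscreteWithin (Metric.sphere (0 : ℂ) |R|) :=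
      codiscreteWithin_mono (subset_univ _) (hg.codiscrete_setOf_analyticAt_and_ne_zero hg')
    filter_upwards [h1, self_mem_codiscreteWithin _] with z hz hzs
    rw [abs_of_pos hR] at hzs
    rw [key z (Metric.sphere_subset_closedBall hzs) hz.1 hz.2, hsum]
    have h0 : ∑ᶠ i, divisor g (Metric.ball 0 R) i *
        Real.log ‖Complex.canonicalFactor R i z‖ = 0 := by
      refine finsum_eq_zero_of_forall_eq_zero fun i ↦ ?_
      by_cases hi : i ∈ Metric.ball (0 : ℂ) R
      · rw [Complex.norm_canonicalFactor_eval_circle_eq_one hi hzs, Real.log_one, mul_zero]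
      · rw [Function.locallyFinsuppWithin.apply_eq_zero_of_notMem _ hi, Int.cast_zero, zero_mul]
    rw [h0, zero_sub, mul_add, mul_neg, Finset.mul_sum, neg_add_eq_sub]
    congr 1
    exact Finset.sum_congr rfl fun i _ ↦ by ring
  rw [Real.circleAverage_congr_codiscreteWithin hcod hR.ne'] at hharm
  have hlogi : ∀ i : ℂ, CircleIntegrable (fun ζ ↦ Real.log ‖ζ - i‖) 0 R := fun i ↦
    MeromorphicOn.circleIntegrable_log_norm (f := fun ζ ↦ ζ - i) (by intro x _; fun_prop)
  have hi : ∀ i ∈ hfin.toFinset, CircleIntegrable (fun ζ ↦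
      (divisor g (Metric.sphere 0 R) i : ℝ) * (poissonKernel 0 w ζ * Real.log ‖ζ - i‖)) 0 R :=
    fun i _ ↦ (circleIntegrable_poissonKernel_mul hw (hlogi i)).const_mul _
  rw [Real.circleAverage_fun_sub (circleIntegrable_poissonKernel_mul hw
    hg.meromorphicOn.circleIntegrable_log_norm) (CircleIntegrable.fun_sum _ hi),
    Real.circleAverage_fun_sum hi, key w (Metric.ball_subset_closedBall hw) hgw hgw', hsum] at hharm
  have h2 : ∀ i ∈ hfin.toFinset, Real.circleAverage (fun ζ ↦
      (divisor g (Metric.sphere 0 R) i : ℝ) * (poissonKernel 0 w ζ * Real.log ‖ζ - i‖)) 0 R =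
      divisor g (Metric.sphere 0 R) i * Real.log ‖w - i‖ := by
    intro i hi
    have hi' : i ∈ Metric.sphere (0 : ℂ) R :=
      (divisor g (Metric.sphere 0 R)).supportWithinDomain (by simpa using hi)
    rw [← circleAverage_poissonKernel_mul_log_norm_sub hw hi', circleAverage_const_mul]
  rw [Finset.sum_congr rfl h2] at hharm
  linarith

/-! ### Two nearby arguments in the Poisson–Jensen formula -/

/-- A Harnack-type estimate: if `w` has distance at least `d` from the circle of radius `R`, then
moving `w` by at most `s ≤ d / 2` changes the Poisson kernel by a relative error of at most
`4 * s / d`. -/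
theorem abs_poissonKernel_sub_poissonKernel_le {R s d : ℝ} {w w' ζ : ℂ} (hd : 0 < d)
    (hζ : ‖ζ‖ = R) (hw : ‖w‖ + d ≤ R) (hs : ‖w' - w‖ ≤ s) (hsd : 2 * s ≤ d) :
    |poissonKernel 0 w' ζ - poissonKernel 0 w ζ| ≤ 4 * s / d * poissonKernel 0 w ζ := by
  have hs0 : 0 ≤ s := (norm_nonneg _).trans hs
  have hR : 0 < R := by linarith [norm_nonneg w]
  have h1 : d ≤ ‖ζ - w‖ := by
    have := norm_sub_norm_le ζ w
    linarith
  have h1' : 0 < ‖ζ - w‖ := hd.trans_le h1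
  have h2 : ‖ζ - w‖ / 2 ≤ ‖ζ - w'‖ := by
    have h3 : ‖ζ - w‖ ≤ ‖ζ - w'‖ + ‖w' - w‖ := by
      simpa using norm_add_le (ζ - w') (w' - w)
    linarith
  have h2' : 0 < ‖ζ - w'‖ := by linarith
  have hne : ζ - w ≠ 0 := norm_pos_iff.1 h1'
  have hne' : ζ - w' ≠ 0 := norm_pos_iff.1 h2'
  have hdiff : poissonKernel 0 w' ζ - poissonKernel 0 w ζ =
      (2 * ζ * (w' - w) / ((ζ - w) * (ζ - w'))).re := by
    rw [poissonKernel_eq_re_herglotzRieszKernel, poissonKernel_eq_re_herglotzRieszKernel]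
    simp only [Function.comp_apply, herglotzRieszKernel_def, sub_zero, ← Complex.sub_re]
    congr 1
    field_simp
    ring
  have hP : R * d / ‖ζ - w‖ ^ 2 ≤ poissonKernel 0 w ζ := by
    rw [poissonKernel_def]
    simp only [sub_zero, hζ]
    gcongr
    nlinarith [norm_nonneg w]
  rw [hdiff]
  calc |(2 * ζ * (w' - w) / ((ζ - w) * (ζ - w'))).re|
      ≤ ‖2 * ζ * (w' - w) / ((ζ - w) * (ζ - w'))‖ := Complex.abs_re_le_norm _
    _ = 2 * R * ‖w' - w‖ / (‖ζ - w‖ * ‖ζ - w'‖) := by simp [hζ]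
    _ ≤ 2 * R * s / (‖ζ - w‖ * (‖ζ - w‖ / 2)) := by gcongr
    _ = 4 * s / d * (R * d / ‖ζ - w‖ ^ 2) := by field_simp; ring
    _ ≤ _ := by gcongr

/-- The inequality `log (1 + t) ≤ t ^ α / α` for `t = ‖x - y‖ / ‖y‖`. -/
theorem log_norm_sub_log_norm_le {x y : ℂ} (hx : x ≠ 0) (hy : y ≠ 0) {α : ℝ} (hα : 0 < α)
    (hα1 : α ≤ 1) : Real.log ‖x‖ - Real.log ‖y‖ ≤ 1 / α * (‖x - y‖ ^ α * ‖y‖ ^ (-α)) := by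
  have hx' := norm_pos_iff.2 hx
  have hy' := norm_pos_iff.2 hy
  have ht : 0 ≤ ‖x - y‖ / ‖y‖ := by positivity
  rw [← Real.log_div hx'.ne' hy'.ne']
  have h1 : ‖x‖ / ‖y‖ ≤ 1 + ‖x - y‖ / ‖y‖ := by
    rw [div_le_iff₀ hy', add_mul, one_mul, div_mul_cancel₀ _ hy'.ne']
    simpa using norm_add_le y (x - y)
  calc Real.log (‖x‖ / ‖y‖) ≤ Real.log (1 + ‖x - y‖ / ‖y‖) := Real.log_le_log (by positivity) h1
    _ = 1 / α * Real.log ((1 + ‖x - y‖ / ‖y‖) ^ α) := by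
        rw [Real.log_rpow (by positivity)]
        field_simp
    _ ≤ 1 / α * ((1 + ‖x - y‖ / ‖y‖) ^ α - 1) := by
        gcongr
        exact Real.log_le_sub_one_of_pos (by positivity)
    _ ≤ 1 / α * (‖x - y‖ / ‖y‖) ^ α := by
        gcongr
        have := Real.rpow_add_le_add_rpow zero_le_one ht hα.le hα1
        rw [Real.one_rpow] at this
        linarith
    _ = _ := by
        rw [Real.div_rpow (norm_nonneg _) (norm_nonneg _), Real.rpow_neg (norm_nonneg _),
          div_eq_mul_inv (‖x - y‖ ^ α)]

theorem abs_log_norm_sub_log_norm_le {x y : ℂ} (hx : x ≠ 0) (hy : y ≠ 0) {α s : ℝ} (hα : 0 < α)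
    (hα1 : α ≤ 1) (hs : ‖x - y‖ ≤ s) :
    |Real.log ‖x‖ - Real.log ‖y‖| ≤ s ^ α / α * (‖x‖ ^ (-α) + ‖y‖ ^ (-α)) := by
  have h1 := log_norm_sub_log_norm_le hx hy hα hα1
  have h2 := log_norm_sub_log_norm_le hy hx hα hα1
  rw [norm_sub_rev] at h2
  have h3 : ‖x - y‖ ^ α ≤ s ^ α := Real.rpow_le_rpow (norm_nonneg _) hs hα.le
  have h4 : ∀ t : ℝ, 0 ≤ t → 1 / α * (‖x - y‖ ^ α * t) ≤ s ^ α / α * t := by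
    intro t ht
    calc 1 / α * (‖x - y‖ ^ α * t) ≤ 1 / α * (s ^ α * t) := by gcongr
      _ = _ := by ring
  have hs0 : 0 ≤ s := (norm_nonneg _).trans hs
  have h5 : 0 ≤ s ^ α / α := by positivity
  have h6 := h4 (‖x‖ ^ (-α)) (by positivity)
  have h7 := h4 (‖y‖ ^ (-α)) (by positivity)
  have h8 : 0 ≤ s ^ α / α * ‖x‖ ^ (-α) := by positivity
  have h9 : 0 ≤ s ^ α / α * ‖y‖ ^ (-α) := by positivity
  rw [abs_le, mul_add]
  constructor <;> linarith

open ComplexConjugate in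
/-- Variation of the logarithm of a Blaschke factor. The last two terms come from the zero of the
numerator, which is the reflection `R ^ 2 / conj i` of `i` in the circle. For `i = 0` there is no
such zero; the two terms are then harmless, being nonnegative. -/
theorem abs_log_norm_canonicalFactor_sub_le {R s α : ℝ} {i w w' : ℂ} (hα : 0 < α) (hα1 : α ≤ 1)
    (hi : i ∈ Metric.ball 0 R) (hw : w ∈ Metric.ball 0 R) (hw' : w' ∈ Metric.ball 0 R)
    (hwi : w ≠ i) (hwi' : w' ≠ i) (hs : ‖w' - w‖ ≤ s) :
    |Real.log ‖Complex.canonicalFactor R i w'‖ - Real.log ‖Complex.canonicalFactor R i w‖| ≤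
      s ^ α / α * (‖w' - i‖ ^ (-α) + ‖w - i‖ ^ (-α)
        + (‖w' - R ^ 2 / conj i‖ ^ (-α) + ‖w - R ^ 2 / conj i‖ ^ (-α))) := by
  have hR : 0 < R := Metric.pos_of_mem_ball hi
  have hs0 : 0 ≤ s := (norm_nonneg _).trans hs
  have hsα : 0 ≤ s ^ α / α := by positivity
  have hnum : ∀ v ∈ Metric.ball (0 : ℂ) R, (R : ℂ) ^ 2 - conj i * v ≠ 0 := by
    intro v hv h0
    have h1 : ‖conj i * v‖ = R ^ 2 := by
      rw [← sub_eq_zero.1 h0]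
      simp
    rw [mem_ball_zero_iff] at hv hi
    rw [norm_mul, RCLike.norm_conj] at h1
    nlinarith [norm_nonneg v, norm_nonneg i]
  have hlog : ∀ v ∈ Metric.ball (0 : ℂ) R, v ≠ i → Real.log ‖Complex.canonicalFactor R i v‖ =
      Real.log ‖(R : ℂ) ^ 2 - conj i * v‖ - Real.log R - Real.log ‖v - i‖ := by
    intro v hv hvi
    have h1 : ‖v - i‖ ≠ 0 := norm_ne_zero_iff.2 (sub_ne_zero.2 hvi)
    rw [Complex.canonicalFactor_apply, norm_div, norm_mul, Complex.norm_real,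
      Real.norm_of_nonneg hR.le, Real.log_div (norm_ne_zero_iff.2 (hnum v hv)) (by positivity),
      Real.log_mul hR.ne' h1]
    ring
  have hA := abs_log_norm_sub_log_norm_le (sub_ne_zero.2 hwi') (sub_ne_zero.2 hwi) hα hα1
    (s := s) (by simpa using hs)
  have hB : |Real.log ‖(R : ℂ) ^ 2 - conj i * w'‖ - Real.log ‖(R : ℂ) ^ 2 - conj i * w‖| ≤
      s ^ α / α * (‖w' - R ^ 2 / conj i‖ ^ (-α) + ‖w - R ^ 2 / conj i‖ ^ (-α)) := by
    by_cases hi0 : i = 0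
    · simp only [hi0, map_zero, zero_mul, sub_zero, sub_self, abs_zero]
      positivity
    · have hc : conj i ≠ 0 := by simpa using hi0
      have heq : ∀ v : ℂ, (R : ℂ) ^ 2 - conj i * v = -conj i * (v - R ^ 2 / conj i) := by
        intro v
        field_simp
        ring
      have hne : ∀ v ∈ Metric.ball (0 : ℂ) R, v - R ^ 2 / conj i ≠ 0 := fun v hv h0 ↦
        hnum v hv (by rw [heq, h0, mul_zero])
      have hc' : ‖-conj i‖ ≠ 0 := norm_ne_zero_iff.2 (neg_ne_zero.2 hc)
      rw [heq, heq, norm_mul, norm_mul, Real.log_mul hc' (norm_ne_zero_iff.2 (hne w' hw')),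
        Real.log_mul hc' (norm_ne_zero_iff.2 (hne w hw)), add_sub_add_left_eq_sub]
      exact abs_log_norm_sub_log_norm_le (hne w' hw') (hne w hw) hα hα1 (by simpa using hs)
  rw [hlog w hw hwi, hlog w' hw' hwi', mul_add]
  rw [abs_le] at hA hB ⊢
  constructor <;> linarith [hA.1, hA.2, hB.1, hB.2]

/-- The Poisson integral of `v`, composed with a polynomial, has the mean value property, because
it is the real part of a holomorphic function. -/
theorem circleAverage_poissonKernel_comp_eval {v : ℂ → ℝ} {R r : ℝ} (hr : 0 < r)
    (hv : CircleIntegrable v 0 R) (p : ℂ[X])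
    (hp : ∀ z ∈ Metric.closedBall (0 : ℂ) r, p.eval z ∈ Metric.ball 0 R) :
    CircleIntegrable (fun z ↦ Real.circleAverage
      (fun ζ ↦ poissonKernel 0 (p.eval z) ζ * v ζ) 0 R) 0 r ∧
    Real.circleAverage (fun z ↦ Real.circleAverage
      (fun ζ ↦ poissonKernel 0 (p.eval z) ζ * v ζ) 0 R) 0 r =
      Real.circleAverage (fun ζ ↦ poissonKernel 0 (p.eval 0) ζ * v ζ) 0 R := by
  have hv' : CircleIntegrable (fun ζ ↦ (v ζ : ℂ)) 0 R := by
    simp only [CircleIntegrable, intervalIntegrable_iff] at hv ⊢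
    exact Complex.ofRealCLM.integrable_comp hv
  set H : ℂ → ℂ := fun w ↦ Real.circleAverage (fun ζ ↦ herglotzRieszKernel 0 w ζ • (v ζ : ℂ)) 0 R
    with hH
  have hHd : ∀ w ∈ Metric.ball (0 : ℂ) R, DifferentiableAt ℂ H w := fun w hw ↦
    (hasDerivAt_circleAverage_herglotzRieszKernel_smul hv' hw).differentiableAt
  have hre : ∀ w ∈ Metric.ball (0 : ℂ) R,
      Real.circleAverage (fun ζ ↦ poissonKernel 0 w ζ * v ζ) 0 R = (H w).re := by
    intro w hw
    rw [hH, re_circleAverage_herglotzRieszKernel_smul hv hw,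
      ← poissonKernel_eq_re_herglotzRieszKernel]
    rfl
  have hcomp : ∀ z ∈ Metric.closedBall (0 : ℂ) r, DifferentiableAt ℂ (fun z ↦ H (p.eval z)) z :=
    fun z hz ↦ DifferentiableAt.comp (g := H) (f := fun z ↦ p.eval z) z (hHd _ (hp z hz))
      p.differentiable.differentiableAt
  have hcont : ContinuousOn (fun z ↦ H (p.eval z)) (Metric.sphere 0 r) := fun z hz ↦
    (hcomp z (Metric.sphere_subset_closedBall hz)).continuousAt.continuousWithinAt
  have hci : CircleIntegrable (fun z ↦ H (p.eval z)) 0 r := hcont.circleIntegrable hr.le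
  have hmean : Real.circleAverage (fun z ↦ H (p.eval z)) 0 r = H (p.eval 0) := by
    have : DiffContOnCl ℂ (fun z ↦ H (p.eval z)) (Metric.ball 0 |r|) := by
      refine DifferentiableOn.diffContOnCl fun z hz ↦ ?_
      rw [abs_of_pos hr, closure_ball _ hr.ne'] at hz
      exact (hcomp z hz).differentiableWithinAt
    exact this.circleAverage
  have hsph : EqOn (fun z ↦ (H (p.eval z)).re) (fun z ↦ Real.circleAverage
      (fun ζ ↦ poissonKernel 0 (p.eval z) ζ * v ζ) 0 R) (Metric.sphere 0 |r|) := by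
    intro z hz
    rw [abs_of_pos hr] at hz
    exact (hre _ (hp z (Metric.sphere_subset_closedBall hz))).symm
  constructor
  · refine (circleIntegrable_congr hsph).1 ?_
    exact ((Complex.continuous_re.comp_continuousOn hcont).circleIntegrable hr.le)
  · rw [← Real.circleAverage_congr_sphere hsph, hre _ (hp 0 (Metric.mem_closedBall_self hr.le)),
      ← hmean]
    exact (Complex.reCLM.circleAverage_comp_comm hci)

/-! ### The proximity function of a quotient of compositions -/

theorem circleAverage_mono_codiscrete {f₁ f₂ : ℂ → ℝ} {c : ℂ} {R : ℝ} (hR : R ≠ 0)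
    (h₁ : CircleIntegrable f₁ c R) (h₂ : CircleIntegrable f₂ c R)
    (h : ∀ᶠ z in codiscrete ℂ, f₁ z ≤ f₂ z) :
    Real.circleAverage f₁ c R ≤ Real.circleAverage f₂ c R := by
  have h' : f₁ =ᶠ[codiscreteWithin (Metric.sphere c |R|)] fun z ↦ min (f₁ z) (f₂ z) := by
    have : {z | f₁ z ≤ f₂ z} ∈ codiscreteWithin (Metric.sphere c |R|) :=
      codiscreteWithin_mono (subset_univ _) h
    filter_upwards [this] with z hz
    exact (min_eq_left hz).symm
  rw [Real.circleAverage_congr_codiscreteWithin h' hR]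
  refine Real.circleAverage_mono (h₁.congr_codiscreteWithin h') h₂ fun z _ ↦ min_le_right _ _

/-- The mean of `|log ‖g‖|` is `m(R, g) + m(R, 1 / g)`. -/
theorem circleAverage_abs_log_norm {g : ℂ → ℂ} (hg : Meromorphic g) (R : ℝ) :
    Real.circleAverage (fun ζ ↦ |Real.log ‖g ζ‖|) 0 R =
      proximity g ⊤ R + proximity g⁻¹ ⊤ R := by
  rw [proximity_top, proximity_top, ← Real.circleAverage_add
    hg.meromorphicOn.circleIntegrable_posLog_norm hg.inv.meromorphicOn.circleIntegrable_posLog_norm]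
  congr 1
  ext z
  simp only [Pi.add_apply, Pi.inv_apply, norm_inv]
  rw [← Real.half_mul_log_add_log_abs, ← Real.half_mul_log_add_log_abs, Real.log_inv, abs_neg]
  ring

open MeromorphicOn in
/-- Difference of the Poisson–Jensen formulas at two points `w` and `w'` of distance at most `s`,
where `w` has distance at least `d` from the circle of radius `R`. -/
theorem Meromorphic.abs_log_norm_sub_log_norm_le {g : ℂ → ℂ} (hg : Meromorphic g)
    (hg' : ∀ u, meromorphicOrderAt g u ≠ ⊤) {R d s α : ℝ} {w w' : ℂ} (hd : 0 < d)
    (hα : 0 < α) (hα1 : α ≤ 1) (hw : ‖w‖ + d ≤ R) (hs : ‖w' - w‖ ≤ s) (hsd : 2 * s ≤ d)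
    (hgw : AnalyticAt ℂ g w) (hgw0 : g w ≠ 0) (hgw' : AnalyticAt ℂ g w') (hgw0' : g w' ≠ 0)
    {T : Finset ℂ} (hT : (divisor g (Metric.ball 0 R)).support = T) :
    |Real.log ‖g w'‖ - Real.log ‖g w‖| ≤
      4 * s / d * Real.circleAverage (fun ζ ↦ poissonKernel 0 w ζ * |Real.log ‖g ζ‖|) 0 R
      + ∑ i ∈ T, |(divisor g (Metric.ball 0 R) i : ℝ)| * (s ^ α / α *
        (‖w' - i‖ ^ (-α) + ‖w - i‖ ^ (-α) + (‖w' - R ^ 2 / starRingEnd ℂ i‖ ^ (-α)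
          + ‖w - R ^ 2 / starRingEnd ℂ i‖ ^ (-α)))) := by
  have hR : 0 < R := by linarith [norm_nonneg w]
  have hwR : w ∈ Metric.ball (0 : ℂ) R := by
    rw [mem_ball_zero_iff]
    linarith
  have hwR' : w' ∈ Metric.ball (0 : ℂ) R := by
    rw [mem_ball_zero_iff]
    have : ‖w'‖ ≤ ‖w‖ + ‖w' - w‖ := by simpa using norm_add_le w (w' - w)
    linarith
  have hsum : ∀ v : ℂ, ∑ᶠ i, divisor g (Metric.ball 0 R) i *
      Real.log ‖Complex.canonicalFactor R i v‖ = ∑ i ∈ T, divisor g (Metric.ball 0 R) i *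
      Real.log ‖Complex.canonicalFactor R i v‖ := by
    intro v
    refine finsum_eq_sum_of_support_subset _ fun i hi ↦ ?_
    rw [← hT]
    intro h0
    simp [h0] at hi
  have hlog : CircleIntegrable (fun ζ ↦ Real.log ‖g ζ‖) 0 R :=
    hg.meromorphicOn.circleIntegrable_log_norm
  have hlog' : CircleIntegrable (fun ζ ↦ |Real.log ‖g ζ‖|) 0 R := hlog.abs
  rw [hg.log_norm_eq_circleAverage_poissonKernel_sub hg' hR hwR hgw hgw0,
    hg.log_norm_eq_circleAverage_poissonKernel_sub hg' hR hwR' hgw' hgw0', hsum, hsum]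
  have hA : |Real.circleAverage (fun ζ ↦ poissonKernel 0 w' ζ * Real.log ‖g ζ‖) 0 R -
      Real.circleAverage (fun ζ ↦ poissonKernel 0 w ζ * Real.log ‖g ζ‖) 0 R| ≤
      4 * s / d * Real.circleAverage (fun ζ ↦ poissonKernel 0 w ζ * |Real.log ‖g ζ‖|) 0 R := by
    have hI := circleIntegrable_poissonKernel_mul hwR hlog
    have hI' := circleIntegrable_poissonKernel_mul hwR' hlog
    rw [← Real.circleAverage_fun_sub hI' hI, ← circleAverage_const_mul]
    refine Real.abs_circleAverage_le_circleAverage_abs.trans ?_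
    refine Real.circleAverage_mono (hI'.sub hI).abs
      ((circleIntegrable_poissonKernel_mul hwR hlog').const_mul _) fun ζ hζ ↦ ?_
    rw [abs_of_pos hR, mem_sphere_zero_iff_norm] at hζ
    have := abs_poissonKernel_sub_poissonKernel_le hd hζ hw hs hsd
    simp only [Pi.abs_apply]
    rw [← sub_mul, abs_mul, ← mul_assoc]
    gcongr
  have hB : |∑ i ∈ T, divisor g (Metric.ball 0 R) i * Real.log ‖Complex.canonicalFactor R i w'‖ -
      ∑ i ∈ T, divisor g (Metric.ball 0 R) i * Real.log ‖Complex.canonicalFactor R i w‖| ≤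
      ∑ i ∈ T, |(divisor g (Metric.ball 0 R) i : ℝ)| * (s ^ α / α *
        (‖w' - i‖ ^ (-α) + ‖w - i‖ ^ (-α) + (‖w' - R ^ 2 / starRingEnd ℂ i‖ ^ (-α)
          + ‖w - R ^ 2 / starRingEnd ℂ i‖ ^ (-α)))) := by
    rw [← Finset.sum_sub_distrib]
    refine (Finset.abs_sum_le_sum_abs _ _).trans (Finset.sum_le_sum fun i hi ↦ ?_)
    have hi0 : divisor g (Metric.ball 0 R) i ≠ 0 := by
      have : i ∈ (divisor g (Metric.ball 0 R)).support := by rw [hT]; exact hi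
      exact this
    have hiR : i ∈ Metric.ball (0 : ℂ) R := by
      by_contra h
      exact hi0 (Function.locallyFinsuppWithin.apply_eq_zero_of_notMem _ h)
    have hne : ∀ v, AnalyticAt ℂ g v → g v ≠ 0 → v ≠ i := by
      rintro v h1 h2 rfl
      apply hi0
      rw [hg.meromorphicOn.divisor_apply hiR,
        h1.meromorphicNFAt.meromorphicOrderAt_eq_zero_iff.2 h2]
      rfl
    rw [← mul_sub, abs_mul]
    exact mul_le_mul_of_nonneg_left (abs_log_norm_canonicalFactor_sub_le hα hα1 hiR hwR hwR'
      (hne w hgw hgw0) (hne w' hgw' hgw0') hs) (abs_nonneg _)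
  rw [abs_le] at hA hB ⊢
  constructor <;> linarith [hA.1, hA.2, hB.1, hB.2]

/-- Harnack's upper bound `(R + ‖w‖) / (R - ‖w‖) ≤ 2` for the Poisson kernel when
`3 * ‖w‖ ≤ R`. -/
theorem circleAverage_poissonKernel_mul_le {v : ℂ → ℝ} {R : ℝ} {w : ℂ} (hv0 : ∀ z, 0 ≤ v z)
    (hv : CircleIntegrable v 0 R) (hR : 0 < R) (hw : 3 * ‖w‖ ≤ R) :
    Real.circleAverage (fun ζ ↦ poissonKernel 0 w ζ * v ζ) 0 R ≤ 2 * Real.circleAverage v 0 R := by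
  have hwR : w ∈ Metric.ball (0 : ℂ) R := by
    rw [mem_ball_zero_iff]
    linarith [norm_nonneg w]
  rw [← circleAverage_const_mul]
  refine Real.circleAverage_mono (circleIntegrable_poissonKernel_mul hwR hv) (hv.const_mul _)
    fun ζ hζ ↦ mul_le_mul_of_nonneg_right ?_ (hv0 ζ)
  rw [abs_of_pos hR] at hζ
  have h1 := re_herglotzRieszKernel_le hζ hwR
  rw [poissonKernel_eq_re_herglotzRieszKernel, Function.comp_apply, herglotzRieszKernel_def]
  refine h1.trans ?_
  rw [sub_zero, div_le_iff₀] <;> linarith [norm_nonneg w]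

open MeromorphicOn in
/-- Estimate for the proximity function of `(g ∘ ω) / (g ∘ φ)`, with no exceptional set of radii.
Here `s` bounds the distance of `ω` and `φ` on the circle of radius `r`, `d` is the distance of
the image of the disc under `φ` from the circle of radius `R`, and `M` bounds the circle means of
`‖ω - b‖ ^ (-α)` and `‖φ - b‖ ^ (-α)`. -/
theorem proximity_comp_div_comp_le {g : ℂ → ℂ} (hg : Meromorphic g)
    (hg' : ∀ u, meromorphicOrderAt g u ≠ ⊤) {ω φ : ℂ[X]} (hω : 1 ≤ ω.natDegree)
    (hφ : 1 ≤ φ.natDegree) {r R d s α M : ℝ} (hr : 0 < r) (hd : 0 < d) (hα : 0 < α)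
    (hα1 : α ≤ 1) (hφR : ∀ z, ‖z‖ ≤ r → ‖φ.eval z‖ + d ≤ R)
    (hs : ∀ z, ‖z‖ = r → ‖ω.eval z - φ.eval z‖ ≤ s) (hsd : 2 * s ≤ d)
    (hφ0 : 3 * ‖φ.eval 0‖ ≤ R)
    (hMω : ∀ b, CircleIntegrable (fun z ↦ ‖ω.eval z - b‖ ^ (-α)) 0 r ∧
      Real.circleAverage (fun z ↦ ‖ω.eval z - b‖ ^ (-α)) 0 r ≤ M)
    (hMφ : ∀ b, CircleIntegrable (fun z ↦ ‖φ.eval z - b‖ ^ (-α)) 0 r ∧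
      Real.circleAverage (fun z ↦ ‖φ.eval z - b‖ ^ (-α)) 0 r ≤ M)
    {T : Finset ℂ} (hT : (divisor g (Metric.ball 0 R)).support = T) :
    proximity (fun z ↦ g (ω.eval z) / g (φ.eval z)) ⊤ r ≤
      8 * s / d * (proximity g ⊤ R + proximity g⁻¹ ⊤ R)
      + 4 * (s ^ α / α) * M * ∑ i ∈ T, |(divisor g (Metric.ball 0 R) i : ℝ)| := by
  have hR : 0 < R := by
    have := hφR 0 (by simpa using hr.le)
    linarith [norm_nonneg (φ.eval 0)]
  have hs0 : 0 ≤ s := (norm_nonneg _).trans (hs r (by simp [abs_of_pos hr]))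
  have hlog' : CircleIntegrable (fun ζ ↦ |Real.log ‖g ζ‖|) 0 R :=
    (hg.meromorphicOn.circleIntegrable_log_norm).abs
  obtain ⟨hu, hu'⟩ := circleAverage_poissonKernel_comp_eval hr hlog' φ fun z hz ↦ by
    rw [mem_closedBall_zero_iff] at hz
    rw [mem_ball_zero_iff]
    linarith [hφR z hz]
  set u : ℂ → ℝ := fun z ↦ Real.circleAverage
    (fun ζ ↦ poissonKernel 0 (φ.eval z) ζ * |Real.log ‖g ζ‖|) 0 R with hudef
  set D : ℂ → ℝ := fun i ↦ |(divisor g (Metric.ball 0 R) i : ℝ)| with hDdef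
  set B : ℂ → ℂ → ℝ := fun i z ↦ D i * (s ^ α / α *
    (‖ω.eval z - i‖ ^ (-α) + ‖φ.eval z - i‖ ^ (-α) + (‖ω.eval z - R ^ 2 / starRingEnd ℂ i‖ ^ (-α)
          + ‖φ.eval z - R ^ 2 / starRingEnd ℂ i‖ ^ (-α)))) with hBdef
  have hB : ∀ i ∈ T, CircleIntegrable (B i) 0 r := fun i _ ↦
    (((((hMω i).1.add (hMφ i).1).add ((hMω _).1.add (hMφ _).1)).const_mul _).const_mul _)
  have hBavg : ∀ i ∈ T, Real.circleAverage (B i) 0 r ≤ 4 * (s ^ α / α) * M * D i := by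
    intro i _
    rw [hBdef]
    simp only
    have hadd : ∀ b, CircleIntegrable
        (fun z ↦ ‖ω.eval z - b‖ ^ (-α) + ‖φ.eval z - b‖ ^ (-α)) 0 r :=
      fun b ↦ (hMω b).1.add (hMφ b).1
    rw [circleAverage_const_mul, circleAverage_const_mul, Real.circleAverage_fun_add
      (hadd i) (hadd _), Real.circleAverage_fun_add
      (hMω i).1 (hMφ i).1, Real.circleAverage_fun_add (hMω _).1 (hMφ _).1]
    have h1 := (hMω i).2
    have h2 := (hMφ i).2
    have h3 := (hMω (R ^ 2 / starRingEnd ℂ i)).2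
    have h4 := (hMφ (R ^ 2 / starRingEnd ℂ i)).2
    calc _ ≤ D i * (s ^ α / α * (4 * M)) := by
          refine mul_le_mul_of_nonneg_left (mul_le_mul_of_nonneg_left ?_ (by positivity))
            (abs_nonneg _)
          linarith
      _ = _ := by ring
  have hgood := hg.codiscrete_setOf_analyticAt_and_ne_zero hg'
  have hmero : Meromorphic fun z ↦ g (ω.eval z) / g (φ.eval z) :=
    (hg.comp_eval ω).div (hg.comp_eval φ)
  rw [proximity_top]
  have hI1 : CircleIntegrable (fun z ↦ 4 * s / d * u z) 0 r := hu.const_mul _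
  have hI2 : CircleIntegrable (fun z ↦ ∑ i ∈ T, B i z) 0 r := CircleIntegrable.fun_sum _ hB
  -- The pointwise estimate holds only on the circle, while `circleAverage_mono_codiscrete` asks for
  -- an inequality on a codiscrete subset of the plane.
  refine (circleAverage_mono_codiscrete hr.ne'
    (f₂ := fun z ↦ if ‖z‖ = r then 4 * s / d * u z + ∑ i ∈ T, B i z else
      Real.posLog ‖g (ω.eval z) / g (φ.eval z)‖)
    hmero.meromorphicOn.circleIntegrable_posLog_norm ?_ ?_).trans ?_
  · refine (circleIntegrable_congr fun z hz ↦ ?_).1 (hI1.add hI2)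
    rw [abs_of_pos hr, mem_sphere_zero_iff_norm] at hz
    simp [hz]
  · filter_upwards [ω.preimage_eval_mem_codiscrete hω hgood,
      φ.preimage_eval_mem_codiscrete hφ hgood] with z hz1 hz2
    split_ifs with hz
    · have := hg.abs_log_norm_sub_log_norm_le hg' hd hα hα1 (hφR z hz.le) (hs z hz) hsd
        hz2.1 hz2.2 hz1.1 hz1.2 hT
      refine le_trans ?_ this
      have h1 : Real.log (‖g (ω.eval z)‖ / ‖g (φ.eval z)‖) = Real.log ‖g (ω.eval z)‖ -
          Real.log ‖g (φ.eval z)‖ :=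
        Real.log_div (norm_ne_zero_iff.2 hz1.2) (norm_ne_zero_iff.2 hz2.2)
      rw [norm_div, Real.posLog_apply, h1]
      exact max_le (abs_nonneg _) (le_abs_self _)
    · exact le_rfl
  · have hc : Real.circleAverage (fun z ↦ if ‖z‖ = r then 4 * s / d * u z + ∑ i ∈ T, B i z else
        Real.posLog ‖g (ω.eval z) / g (φ.eval z)‖) 0 r =
        Real.circleAverage (fun z ↦ 4 * s / d * u z + ∑ i ∈ T, B i z) 0 r := by
      refine Real.circleAverage_congr_sphere fun z hz ↦ ?_
      rw [abs_of_pos hr, mem_sphere_zero_iff_norm] at hz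
      simp [hz]
    rw [hc, Real.circleAverage_fun_add hI1 hI2, circleAverage_const_mul, hu',
      Real.circleAverage_fun_sum hB, Finset.mul_sum]
    refine add_le_add ?_ (Finset.sum_le_sum hBavg)
    have := circleAverage_poissonKernel_mul_le (fun z ↦ abs_nonneg _) hlog' hR hφ0
    rw [circleAverage_abs_log_norm hg] at this
    calc _ ≤ 4 * s / d * (2 * (proximity g ⊤ R + proximity g⁻¹ ⊤ R)) := by gcongr
      _ = _ := by ring

open MeromorphicOn Function.locallyFinsuppWithin in
/-- The number of zeros and poles in the disc of radius `R` is controlled by the integrated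
counting functions at a larger radius `R'`. -/
theorem sum_abs_divisor_mul_log_le {g : ℂ → ℂ} (hg : Meromorphic g) {R R' : ℝ} (hR : 1 ≤ R)
    (hRR' : R < R') {T : Finset ℂ} (hT : (divisor g (Metric.ball 0 R)).support = T) :
    (∑ i ∈ T, |(divisor g (Metric.ball 0 R) i : ℝ)|) * Real.log (R' / R) ≤
      ValueDistribution.logCounting g 0 R' + ValueDistribution.logCounting g ⊤ R' := by
  classical
  set D := divisor g univ
  have hmem : ∀ i ∈ T, i ∈ Metric.ball (0 : ℂ) R ∧ divisor g (Metric.ball 0 R) i = D i := by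
    intro i hi
    have hi0 : divisor g (Metric.ball 0 R) i ≠ 0 := by
      have : i ∈ (divisor g (Metric.ball 0 R)).support := by rw [hT]; exact hi
      exact this
    have hiR : i ∈ Metric.ball (0 : ℂ) R := by
      by_contra h
      exact hi0 (Function.locallyFinsuppWithin.apply_eq_zero_of_notMem _ h)
    refine ⟨hiR, ?_⟩
    rw [hg.meromorphicOn.divisor_apply hiR, hg.meromorphicOn.divisor_apply (mem_univ _)]
  set S : Function.locallyFinsupp ℂ ℤ := ∑ i ∈ T, single i |D i| with hS
  have hle : S ≤ D⁺ + D⁻ := by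
    intro z
    rw [hS]
    simp only [coe_sum, Finset.sum_apply, single_apply, Finset.sum_ite_eq,
      Function.locallyFinsuppWithin.coe_add, Pi.add_apply]
    have habs : D⁺ z + D⁻ z = |D z| := by
      have h1 : D⁺ z = (D z)⁺ := rfl
      have h2 : D⁻ z = (D z)⁻ := rfl
      rw [h1, h2, posPart_add_negPart]
    rw [habs]
    split_ifs <;> simp
  have hR' : 1 ≤ R' := hR.trans hRR'.le
  have h1 := Function.locallyFinsuppWithin.logCounting_le hle hR'
  rw [map_add, Pi.add_apply, ← ValueDistribution.logCounting_zero,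
    ← ValueDistribution.logCounting_top] at h1
  refine le_trans ?_ h1
  rw [hS, map_sum, Finset.sum_apply, Finset.sum_mul]
  refine Finset.sum_le_sum fun i hi ↦ ?_
  obtain ⟨hiR, hDi⟩ := hmem i hi
  rw [mem_ball_zero_iff] at hiR
  rw [logCounting_single_eq_log_sub_const (hiR.le.trans hRR'.le), hDi, Int.cast_abs]
  refine mul_le_mul_of_nonneg_left ?_ (abs_nonneg _)
  rw [Real.log_div (by linarith) (by linarith)]
  have : Real.log ‖i‖ ≤ Real.log R := by
    rcases eq_or_ne i 0 with rfl | hi0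
    · simpa using Real.log_nonneg hR
    · exact Real.log_le_log (norm_pos_iff.2 hi0) hiR.le
  linarith

/-! ### A growth lemma of Borel type -/

theorem HasFiniteLogMeasure.union_Iic {E : Set ℝ} (hE : HasFiniteLogMeasure E) (a : ℝ) :
    HasFiniteLogMeasure (Iic a ∪ E) := by
  refine ⟨measurableSet_Iic.union hE.1, ?_⟩
  rw [union_inter_distrib_right]
  refine (lintegral_union_le _ _ _).trans_lt (ENNReal.add_lt_top.2 ⟨?_, hE.2⟩)
  rw [inter_comm, Ici_inter_Iic]
  calc ∫⁻ t in Icc 1 a, ENNReal.ofReal (1 / t) ≤ ∫⁻ _ in Icc 1 a, 1 := by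
        refine setLIntegral_mono' measurableSet_Icc fun t ht ↦ ?_
        rw [ENNReal.ofReal_le_one]
        exact (div_le_one (by linarith [ht.1])).2 ht.1
    _ < ⊤ := by simp

theorem Monotone.integral_add_sub_le {U : ℝ → ℝ} (hU : Monotone U) (hU0 : ∀ t, 0 ≤ U t)
    {a b h : ℝ} (hh : 0 ≤ h) :
    ∫ t in a..b, (U (t + h) - U t) ≤ h * U (b + h) := by
  have hi : ∀ x y, IntervalIntegrable U volume x y := fun x y ↦ hU.intervalIntegrable
  have hi' : IntervalIntegrable (fun t ↦ U (t + h)) volume a b :=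
    (hU.comp (fun x y hxy ↦ by simpa using hxy : Monotone fun t : ℝ ↦ t + h)).intervalIntegrable
  rw [intervalIntegral.integral_sub hi' (hi _ _), intervalIntegral.integral_comp_add_right U h,
    intervalIntegral.integral_interval_sub_interval_comm' (hi _ _) (hi _ _) (hi _ _)]
  have h1 : ∫ t in b..(b + h), U t ≤ h * U (b + h) := by
    calc ∫ t in b..(b + h), U t ≤ ∫ _ in b..(b + h), U (b + h) :=
          intervalIntegral.integral_mono_on (by linarith) (hi _ _) (by simp) fun x hx ↦ hU hx.2
      _ = _ := by simp
  have h2 : 0 ≤ ∫ t in a..(a + h), U t :=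
    intervalIntegral.integral_nonneg (by linarith) fun t _ ↦ hU0 t
  linarith

/-- A Borel-type growth lemma for functions whose logarithm `U` is `O(r ^ κ)`. On a dyadic block
`[A, 2 A]` the exceptional set has measure at most a constant times
`∫ (U (t + h) - U t) ≤ h * U (4 A)` with `h = (2 A) ^ (1 - μ)`. Its logarithmic measure is
therefore `O(A ^ (κ - μ))`, which is summable over the blocks. -/
theorem hasFiniteLogMeasure_setOf_two_mul_lt {V : ℝ → ℝ} (hV : Monotone V) (hV1 : ∀ r, 1 ≤ V r)
    {C κ μ : ℝ} (hκ : 0 < κ) (hκμ : κ < μ) (hμ : μ < 1)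
    (hlog : ∀ r, 1 ≤ r → Real.log (V r) ≤ C * r ^ κ) :
    HasFiniteLogMeasure {r | 1 ≤ r ∧ 2 * V r < V (r + r ^ (1 - μ))} := by
  set E := {r | 1 ≤ r ∧ 2 * V r < V (r + r ^ (1 - μ))} with hE
  have hmeasE : MeasurableSet E := by
    have h1 : MeasurableSet {r : ℝ | 2 * V r < V (r + r ^ (1 - μ))} :=
      measurableSet_lt (hV.measurable.const_mul 2) (hV.measurable.comp (by fun_prop))
    exact measurableSet_Ici.inter h1
  refine ⟨hmeasE, ?_⟩
  set U : ℝ → ℝ := fun r ↦ Real.log (V r) with hUdef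
  have hU : Monotone U := fun x y hxy ↦ Real.log_le_log (by linarith [hV1 x]) (hV hxy)
  have hU0 : ∀ t, 0 ≤ U t := fun t ↦ Real.log_nonneg (hV1 t)
  have hlog2 : 0 < Real.log 2 := Real.log_pos one_lt_two
  have hC : 0 ≤ C := by simpa using (hU0 1).trans (hlog 1 le_rfl)
  set K : ℝ := (Real.log 2)⁻¹ * (2 ^ (1 - μ) * (C * 4 ^ κ)) with hK
  have hblock : ∀ A : ℝ, 1 ≤ A →
      ∫⁻ t in E ∩ Icc A (2 * A), ENNReal.ofReal (1 / t) ≤ ENNReal.ofReal (K * A ^ (κ - μ)) := by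
    intro A hA
    have hA0 : 0 < A := by linarith
    set h : ℝ := (2 * A) ^ (1 - μ) with hh
    have hh0 : 0 ≤ h := by positivity
    have hh2 : h ≤ 2 * A := by
      calc h ≤ (2 * A) ^ (1 : ℝ) := Real.rpow_le_rpow_of_exponent_le (by linarith) (by linarith)
        _ = 2 * A := Real.rpow_one _
    set S := E ∩ Icc A (2 * A) with hS
    have hmS : MeasurableSet S := hmeasE.inter measurableSet_Icc
    have hSfin : volume S ≠ ⊤ := ((measure_mono inter_subset_right).trans_lt (by simp)).ne
    have hg0 : ∀ t, 0 ≤ U (t + h) - U t := fun t ↦ by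
      have : U t ≤ U (t + h) := hU (by linarith)
      linarith
    have hgi : IntegrableOn (fun t ↦ U (t + h) - U t) (Icc A (2 * A)) := by
      have : IntervalIntegrable (fun t ↦ U (t + h) - U t) volume A (2 * A) :=
        ((hU.comp (fun x y hxy ↦ by simpa using hxy : Monotone fun t : ℝ ↦ t + h)
          ).intervalIntegrable).sub hU.intervalIntegrable
      rw [integrableOn_Icc_iff_integrableOn_Ioc]
      exact (intervalIntegrable_iff_integrableOn_Ioc_of_le (by linarith)).1 this
    -- On `S` the increment of `U` is at least `log 2`.
    have h1 : volume.real S * Real.log 2 ≤ h * (C * (4 * A) ^ κ) := by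
      calc volume.real S * Real.log 2 = ∫ _ in S, Real.log 2 := by simp
        _ ≤ ∫ t in S, (U (t + h) - U t) := by
            refine setIntegral_mono_on (integrableOn_const hSfin)
              (hgi.mono_set inter_subset_right) hmS fun t ht ↦ ?_
            have ht1 : t ^ (1 - μ) ≤ h :=
              Real.rpow_le_rpow (by linarith [ht.1.1]) ht.2.2 (by linarith)
            have h3 : 2 * V t < V (t + h) := ht.1.2.trans_le (hV (by linarith))
            have h4 := Real.log_le_log (by linarith [hV1 t]) h3.le
            rw [Real.log_mul two_ne_zero (by linarith [hV1 t])] at h4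
            simp only [hUdef]
            linarith
        _ ≤ ∫ t in Icc A (2 * A), (U (t + h) - U t) :=
            setIntegral_mono_set hgi (Eventually.of_forall hg0)
              (LE.le.eventuallyLE inter_subset_right)
        _ = ∫ t in A..(2 * A), (U (t + h) - U t) := by
            rw [integral_Icc_eq_integral_Ioc, intervalIntegral.integral_of_le (by linarith)]
        _ ≤ h * U (2 * A + h) := hU.integral_add_sub_le hU0 hh0
        _ ≤ h * (C * (4 * A) ^ κ) := by
            gcongr
            exact (hU (by linarith)).trans (hlog (4 * A) (by linarith))
    calc ∫⁻ t in S, ENNReal.ofReal (1 / t) ≤ ∫⁻ _ in S, ENNReal.ofReal (1 / A) := by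
          refine setLIntegral_mono' hmS fun t ht ↦ ENNReal.ofReal_le_ofReal ?_
          exact one_div_le_one_div_of_le hA0 ht.2.1
      _ = ENNReal.ofReal (1 / A * volume.real S) := by
          rw [setLIntegral_const, ENNReal.ofReal_mul (by positivity), Measure.real,
            ENNReal.ofReal_toReal hSfin]
      _ ≤ ENNReal.ofReal (K * A ^ (κ - μ)) := by
          refine ENNReal.ofReal_le_ofReal ?_
          have h5 : volume.real S ≤ (Real.log 2)⁻¹ * (h * (C * (4 * A) ^ κ)) := by
            rw [inv_mul_eq_div, le_div_iff₀ hlog2]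
            exact h1
          calc 1 / A * volume.real S ≤ 1 / A * ((Real.log 2)⁻¹ * (h * (C * (4 * A) ^ κ))) := by
                gcongr
            _ = K * (A ^ (1 - μ) * A ^ κ * A ^ (-1 : ℝ)) := by
                rw [hh, hK, Real.mul_rpow two_pos.le hA0.le, Real.mul_rpow four_pos.le hA0.le,
                  Real.rpow_neg_one]
                ring
            _ = K * A ^ (κ - μ) := by
                rw [← Real.rpow_add hA0, ← Real.rpow_add hA0]
                congr 2
                ring
  have hcover : E ∩ Ici 1 ⊆ ⋃ k : ℕ, E ∩ Icc ((2 : ℝ) ^ k) (2 * 2 ^ k) := by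
    rintro t ⟨htE, ht1⟩
    obtain ⟨k, hk1, hk2⟩ := exists_nat_pow_near (mem_Ici.1 ht1) one_lt_two
    refine mem_iUnion.2 ⟨k, htE, hk1, ?_⟩
    rw [pow_succ'] at hk2
    exact hk2.le
  have hq : (2 : ℝ) ^ (κ - μ) < 1 := Real.rpow_lt_one_of_one_lt_of_neg one_lt_two (by linarith)
  have hsummable : Summable fun k : ℕ ↦ K * ((2 : ℝ) ^ (κ - μ)) ^ k :=
    (summable_geometric_of_lt_one (by positivity) hq).mul_left K
  calc ∫⁻ t in E ∩ Ici 1, ENNReal.ofReal (1 / t)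
      ≤ ∫⁻ t in ⋃ k : ℕ, E ∩ Icc ((2 : ℝ) ^ k) (2 * 2 ^ k), ENNReal.ofReal (1 / t) :=
        lintegral_mono_set hcover
    _ ≤ ∑' k : ℕ, ∫⁻ t in E ∩ Icc ((2 : ℝ) ^ k) (2 * 2 ^ k), ENNReal.ofReal (1 / t) :=
        lintegral_iUnion_le _ _
    _ ≤ ∑' k : ℕ, ENNReal.ofReal (K * ((2 : ℝ) ^ (κ - μ)) ^ k) := by
        refine ENNReal.tsum_le_tsum fun k ↦ ?_
        refine (hblock _ (one_le_pow₀ one_le_two)).trans (le_of_eq ?_)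
        rw [← Real.rpow_natCast, ← Real.rpow_natCast, ← Real.rpow_mul two_pos.le,
          ← Real.rpow_mul two_pos.le, mul_comm (κ - μ)]
    _ < ⊤ := hsummable.tsum_ofReal_lt_top

/-! ### Comparing the characteristics of a function and of its composition with a polynomial -/

open Function in
/-- Each linear factor `z - u` of `p - b` has logarithmic mean `max (log r) (log ‖u‖) ≥ log r`. -/
theorem Polynomial.log_le_circleAverage_log_norm_eval_sub (p : ℂ[X]) (hp : 1 ≤ p.natDegree)
    (b : ℂ) {r : ℝ} (hr : 0 < r) :
    Real.log (‖p.leadingCoeff‖ * r ^ p.natDegree) ≤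
      Real.circleAverage (fun z ↦ Real.log ‖p.eval z - b‖) 0 r := by
  obtain ⟨u, hu⟩ := p.exists_eval_sub_eq_prod hp b
  have hc : p.leadingCoeff ≠ 0 := by
    rw [Ne, leadingCoeff_eq_zero]; rintro rfl; simp at hp
  have hi : ∀ i, CircleIntegrable (fun z ↦ Real.log ‖z - u i‖) 0 r := fun i ↦
    circleIntegrable_log_norm_sub_const r
  have hev : (fun z ↦ Real.log ‖p.eval z - b‖) =ᶠ[codiscrete ℂ]
      fun z ↦ Real.log ‖p.leadingCoeff‖ + ∑ i, Real.log ‖z - u i‖ := by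
    have : {z | ∀ i, z ≠ u i} ∈ codiscrete ℂ := by
      have h2 : (range u)ᶜ ∈ codiscrete ℂ :=
        (finite_range u).compl_mem_codiscrete
      filter_upwards [h2] with z hz i h
      exact hz ⟨i, h.symm⟩
    filter_upwards [this] with z hz
    rw [hu, norm_mul, norm_prod, Real.log_mul (by simpa using hc)
      (Finset.prod_ne_zero_iff.2 fun i _ ↦ by simpa [sub_eq_zero] using hz i),
      Real.log_prod fun i _ ↦ by simpa [sub_eq_zero] using hz i]
  rw [Real.circleAverage_congr_codiscreteWithin
      (hev.filter_mono (codiscreteWithin_mono (subset_univ _))) hr.ne',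
    Real.circleAverage_fun_add (circleIntegrable_const _ _ _)
      (CircleIntegrable.fun_sum _ fun i _ ↦ hi i),
    Real.circleAverage_const, Real.circleAverage_fun_sum fun i _ ↦ hi i,
    Real.log_mul (by simpa using hc) (by positivity), Real.log_pow]
  gcongr
  have : ∀ i, Real.log r ≤ Real.circleAverage (fun z ↦ Real.log ‖z - u i‖) 0 r := fun i ↦ by
    rw [circleAverage_log_norm_sub_const_eq_log_radius_add_posLog hr.ne']
    linarith [Real.posLog_nonneg (x := r⁻¹ * ‖0 - u i‖)]
  simpa using Finset.sum_le_sum fun i (_ : i ∈ Finset.univ) ↦ this i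

open Function in
/-- Jensen's formula: a lower bound for the counting function of the `b`-points of `p`. -/
theorem Polynomial.log_sub_le_logCounting_divisor_eval_sub (p : ℂ[X]) (hp : 1 ≤ p.natDegree)
    (b : ℂ) {r : ℝ} (hr : 0 < r) :
    Real.log (‖p.leadingCoeff‖ * r ^ p.natDegree)
        - Real.log ‖meromorphicTrailingCoeffAt (fun z ↦ p.eval z - b) 0‖ ≤
      (MeromorphicOn.divisor (fun z ↦ p.eval z - b) univ).logCounting r := by
  rw [locallyFinsuppWithin.logCounting_divisor_eq_circleAverage_sub_const ?_ hr.ne']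
  · gcongr
    exact p.log_le_circleAverage_log_norm_eval_sub hp b hr
  · intro z
    have := p.differentiable.analyticAt z
    fun_prop

/-- A zero `b` of `g` of order `m` pulls back to the zeros of `p - b`, with multiplicities
multiplied by `m`. -/
theorem sum_smul_divisor_eval_sub_le {g : ℂ → ℂ} (hg : Meromorphic g) (p : ℂ[X])
    (hp : 1 ≤ p.natDegree) (S : Finset ℂ) :
    ∑ b ∈ S, (MeromorphicOn.divisor g univ)⁺ b •
        MeromorphicOn.divisor (fun z ↦ p.eval z - b) univ ≤
      (MeromorphicOn.divisor (fun z ↦ g (p.eval z)) univ)⁺ := by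
  intro u
  have hp' : ∀ b, AnalyticOnNhd ℂ (fun z ↦ p.eval z - b) univ := fun b z _ ↦ by
    have := p.differentiable.analyticAt z
    fun_prop
  have hord := (hg (p.eval u)).meromorphicOrderAt_comp (p.differentiable.analyticAt u)
    (p.not_eventuallyConst_eval hp u)
  have hcomp : MeromorphicOn.divisor (fun z ↦ g (p.eval z)) univ u =
      MeromorphicOn.divisor g univ (p.eval u) *
        MeromorphicOn.divisor (fun z ↦ p.eval z - p.eval u) univ u := by
    rw [MeromorphicOn.divisor_apply (hg.comp_eval p).meromorphicOn (mem_univ _),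
      MeromorphicOn.divisor_apply hg.meromorphicOn (mem_univ _),
      MeromorphicOn.AnalyticOnNhd.divisor_apply (hp' _) (mem_univ _), ← WithTop.untop₀_mul, ← hord]
    rfl
  have hnn : 0 ≤ MeromorphicOn.divisor (fun z ↦ p.eval z - p.eval u) univ u :=
    MeromorphicOn.AnalyticOnNhd.divisor_nonneg (hp' _) u
  have hz : ∀ b, b ≠ p.eval u → MeromorphicOn.divisor (fun z ↦ p.eval z - b) univ u = 0 := by
    intro b hb
    rw [MeromorphicOn.AnalyticOnNhd.divisor_apply (hp' _) (mem_univ _),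
      ((hp' b) u (mem_univ _)).analyticOrderAt_eq_zero.2 (by simpa [sub_eq_zero] using hb.symm)]
    simp
  rw [Function.locallyFinsuppWithin.coe_sum, Finset.sum_apply,
    Function.locallyFinsuppWithin.posPart_apply, hcomp]
  have hle : (MeromorphicOn.divisor g univ (p.eval u))⁺ *
      MeromorphicOn.divisor (fun z ↦ p.eval z - p.eval u) univ u ≤
      (MeromorphicOn.divisor g univ (p.eval u) *
        MeromorphicOn.divisor (fun z ↦ p.eval z - p.eval u) univ u)⁺ := by
    rcases le_total 0 (MeromorphicOn.divisor g univ (p.eval u)) with h | h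
    · rw [posPart_of_nonneg h]; exact le_posPart _
    · rw [posPart_of_nonpos h, zero_mul]; exact posPart_nonneg _
  refine le_trans ?_ hle
  by_cases hm : p.eval u ∈ S
  · rw [Finset.sum_eq_single_of_mem _ hm fun b _ hb ↦ by
      simp [hz b hb]]
    simp
  · rw [Finset.sum_eq_zero fun b hb ↦ ?_]
    · exact mul_nonneg (posPart_nonneg _) hnn
    · simp [hz b (fun h ↦ hm (h ▸ hb))]

open Function in
/-- The counting function is a sum of contributions of single points, where `S` consists of the
points of the support in the closed disc of radius `ρ`. Subtracting the value at radius `1`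
removes the unbounded terms `log ‖b‖` of points close to `0`. -/
theorem logCounting_sub_logCounting_one_le {D : locallyFinsupp ℂ ℤ} (hD : 0 ≤ D) {ρ : ℝ}
    (hρ : 1 ≤ ρ) {S : Finset ℂ} (hS : ∀ b, b ∈ S ↔ D b ≠ 0 ∧ ‖b‖ ≤ ρ) :
    D.logCounting ρ - D.logCounting 1 ≤ ∑ b ∈ S, D b * (Real.log ρ - Real.posLog ‖b‖) := by
  classical
  set D₁ : locallyFinsupp ℂ ℤ := ∑ b ∈ S, locallyFinsuppWithin.single b (D b) with hD₁
  have hD₁a : ∀ z, D₁ z = if z ∈ S then D z else 0 := by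
    intro z
    simp [hD₁, locallyFinsuppWithin.coe_sum]
  -- The part `D₂` of `D` outside the disc of radius `ρ` does not contribute at radius `ρ`.
  set D₂ := D - D₁ with hD₂def
  have hD₂a : ∀ z, D₂ z = if z ∈ S then 0 else D z := by
    intro z
    have := hD₁a z
    simp only [hD₂def, locallyFinsuppWithin.coe_sub, Pi.sub_apply]
    split_ifs at this ⊢ <;> lia
  have hD₂ : 0 ≤ D₂ := by
    intro z
    rw [hD₂a z]
    split_ifs
    · simp
    · exact hD z
  have h1 : 0 ≤ D₂.logCounting 1 := locallyFinsuppWithin.logCounting_nonneg hD₂ le_rfl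
  have h2 : D₂.logCounting ρ = 0 := by
    have hz : ∀ z, ‖z‖ ≤ ρ → D₂ z = 0 := by
      intro z hz
      rw [hD₂a z]
      split_ifs with h
      · rfl
      · by_contra h'
        exact h ((hS z).2 ⟨h', hz⟩)
    simp only [locallyFinsuppWithin.logCounting, AddMonoidHom.coe_mk, ZeroHom.coe_mk,
      hz 0 (by simp; linarith), Int.cast_zero, zero_mul, add_zero]
    refine finsum_eq_zero_of_forall_eq_zero fun z ↦ ?_
    by_cases hzz : z ∈ Metric.closedBall 0 |ρ|
    · rw [locallyFinsuppWithin.toClosedBall_eval_within _ hzz, hz z]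
      · simp
      · simpa [abs_of_nonneg (by linarith : 0 ≤ ρ)] using hzz
    · simp [locallyFinsuppWithin.apply_eq_zero_of_notMem _ hzz]
  have h3 : D₁.logCounting ρ - D₁.logCounting 1 ≤
      ∑ b ∈ S, D b * (Real.log ρ - Real.posLog ‖b‖) := by
    simp only [hD₁, map_sum, Finset.sum_apply, ← Finset.sum_sub_distrib]
    refine Finset.sum_le_sum fun b hb ↦ ?_
    have hb' : 0 ≤ (D b : ℝ) := by exact_mod_cast hD b
    rw [locallyFinsuppWithin.logCounting_single_eq_log_sub_const ((hS b).1 hb).2]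
    rcases le_total ‖b‖ 1 with h | h
    · rw [locallyFinsuppWithin.logCounting_single_eq_log_sub_const h,
        (Real.posLog_eq_zero_iff _).2 (by simpa using h)]
      simp only [Real.log_one]
      linarith
    · rw [Real.posLog_eq_log (by simpa using h)]
      have : 0 ≤ (locallyFinsuppWithin.single b (D b)).logCounting 1 := by
        refine locallyFinsuppWithin.logCounting_nonneg (fun z ↦ ?_) le_rfl
        rw [locallyFinsuppWithin.single_apply]
        split_ifs
        · exact hD b
        · simp
      linarith
  have h4 : D.logCounting = D₁.logCounting + D₂.logCounting := by
    rw [← map_add, hD₂def, add_sub_cancel]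
  rw [h4, Pi.add_apply, Pi.add_apply]
  linarith

/-- Lower bound for the contribution of a single point `b` to the counting function of the
composition, where `ρ + ‖p 0‖` is to be the radius `‖lc p‖ * r ^ n`. If `b ≠ p 0`, the trailing
coefficient of `p - b` at `0` is `p 0 - b`. With `K = ‖p 0‖` and `x = max 1 ‖b‖`, the estimate
then amounts to `(ρ - x) * (ρ * x - K ^ 2) ≥ 0`. The case `b = p 0` needs the separate lower bound
`hρ₁` for `ρ`. -/
theorem Polynomial.half_log_sub_posLog_le (p : ℂ[X]) {ρ : ℝ} (hρ : 1 ≤ ρ)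
    (hρ₀ : ‖p.eval 0‖ ^ 2 ≤ ρ)
    (hρ₁ : ‖meromorphicTrailingCoeffAt (fun z ↦ p.eval z - p.eval 0) 0‖ ^ 2 ≤ ρ)
    (ht : meromorphicTrailingCoeffAt (fun z ↦ p.eval z - p.eval 0) 0 ≠ 0) {b : ℂ} (hb : ‖b‖ ≤ ρ) :
    (Real.log ρ - Real.posLog ‖b‖) / 2 ≤ Real.log (ρ + ‖p.eval 0‖)
        - Real.log ‖meromorphicTrailingCoeffAt (fun z ↦ p.eval z - b) 0‖ := by
  set t := ‖meromorphicTrailingCoeffAt (fun z ↦ p.eval z - b) 0‖ with htdef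
  set K := ‖p.eval 0‖ with hK
  have hK0 : 0 ≤ K := norm_nonneg _
  set x := max 1 ‖b‖ with hx
  have hx1 : 1 ≤ x := le_max_left _ _
  have hxρ : x ≤ ρ := max_le hρ hb
  have hlog : Real.posLog ‖b‖ = Real.log x := by
    rw [Real.posLog_eq_log_max_one (norm_nonneg _)]
  obtain ⟨ht0, hle⟩ : 0 < t ∧ ρ * t ^ 2 ≤ (ρ + K) ^ 2 * x := by
    by_cases hb0 : b = p.eval 0
    · rw [← hb0] at hρ₁ ht
      rw [← htdef] at hρ₁
      refine ⟨norm_pos_iff.2 ht, ?_⟩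
      calc ρ * t ^ 2 ≤ ρ * ρ := by gcongr
        _ ≤ (ρ + K) ^ 2 * 1 := by nlinarith
        _ ≤ _ := by gcongr
    · have hne : p.eval 0 - b ≠ 0 := sub_ne_zero.2 (Ne.symm hb0)
      have han : AnalyticAt ℂ (fun z ↦ p.eval z - b) 0 := by
        have := p.differentiable.analyticAt 0
        fun_prop
      have hte : t = ‖p.eval 0 - b‖ := by
        rw [htdef, han.meromorphicTrailingCoeffAt_of_ne_zero hne]
      refine ⟨hte ▸ norm_pos_iff.2 hne, ?_⟩
      have htle : t ≤ K + x := by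
        rw [hte]
        exact (norm_sub_le _ _).trans (by gcongr; exact le_max_right _ _)
      have ht0 : 0 ≤ t := norm_nonneg _
      calc ρ * t ^ 2 ≤ ρ * (K + x) ^ 2 := by gcongr
        _ ≤ _ := by
          have : 0 ≤ (ρ - x) * (ρ * x - K ^ 2) := by
            refine mul_nonneg (by linarith) ?_
            nlinarith
          nlinarith
  have h := Real.log_le_log (by positivity) hle
  rw [Real.log_mul (by positivity) (by positivity), Real.log_mul (by positivity) (by positivity),
    Real.log_pow, Real.log_pow] at h
  rw [hlog]
  push_cast at h
  linarith

open Function in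
/-- The threshold `ρ₀` is uniform in `g`, so that the estimate can be averaged over `g = f - a`
for `a` on the unit circle. -/
theorem logCounting_le_two_mul_logCounting_comp {p : ℂ[X]} (hp : 1 ≤ p.natDegree) :
    ∃ ρ₀ : ℝ, 1 ≤ ρ₀ ∧ ∀ g : ℂ → ℂ, Meromorphic g → ∀ r : ℝ, 1 ≤ r →
      ρ₀ ≤ ‖p.leadingCoeff‖ * r ^ p.natDegree - ‖p.eval 0‖ →
      logCounting g 0 (‖p.leadingCoeff‖ * r ^ p.natDegree - ‖p.eval 0‖) - logCounting g 0 1 ≤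
        2 * logCounting (fun z ↦ g (p.eval z)) 0 r := by
  set t := meromorphicTrailingCoeffAt (fun z ↦ p.eval z - p.eval 0) 0 with htdef
  have hpa : ∀ b z, AnalyticAt ℂ (fun z ↦ p.eval z - b) z := fun b z ↦ by
    have := p.differentiable.analyticAt z
    fun_prop
  have ht : t ≠ 0 := by
    refine (hpa _ 0).meromorphicAt.meromorphicTrailingCoeffAt_ne_zero ?_
    rw [(hpa _ 0).meromorphicOrderAt_eq]
    intro h
    rw [ENat.map_eq_top_iff, analyticOrderAt_eq_top] at h
    refine p.not_eventuallyConst_eval hp 0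
      (eventuallyConst_iff_exists_eventuallyEq.2 ⟨p.eval 0, h.mono fun z hz ↦ ?_⟩)
    simpa [sub_eq_zero] using hz
  refine ⟨max 1 (max (‖p.eval 0‖ ^ 2) (‖t‖ ^ 2)), le_max_left _ _, fun g hg r hr hρ ↦ ?_⟩
  set ρ := ‖p.leadingCoeff‖ * r ^ p.natDegree - ‖p.eval 0‖ with hρdef
  simp only [max_le_iff] at hρ
  obtain ⟨hρ1, hρ2, hρ3⟩ := hρ
  rw [logCounting_zero, logCounting_zero]
  set D := (MeromorphicOn.divisor g univ)⁺ with hDdef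
  have hD : 0 ≤ D := posPart_nonneg _
  have hfin : {b | D b ≠ 0 ∧ ‖b‖ ≤ ρ}.Finite := by
    have := (locallyFinsuppWithin.toClosedBall ρ D).finiteSupport (isCompact_closedBall 0 |ρ|)
    refine this.subset fun b hb ↦ ?_
    have hbb : b ∈ Metric.closedBall 0 |ρ| := by
      simpa [abs_of_nonneg (by linarith : 0 ≤ ρ)] using hb.2
    simpa [locallyFinsuppWithin.toClosedBall_eval_within _ hbb] using hb.1
  have h1 := logCounting_sub_logCounting_one_le hD hρ1 (S := hfin.toFinset) (by simp)
  have h2 := locallyFinsuppWithin.logCounting_le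
    (sum_smul_divisor_eval_sub_le hg p hp hfin.toFinset) hr
  simp only [map_sum, Finset.sum_apply, map_zsmul, zsmul_eq_mul, Pi.mul_apply,
    Pi.intCast_apply] at h2
  rw [← hDdef] at h2
  refine h1.trans (le_trans ?_ (mul_le_mul_of_nonneg_left h2 two_pos.le))
  rw [Finset.mul_sum]
  refine Finset.sum_le_sum fun b hb ↦ ?_
  have hb' : 0 ≤ (D b : ℝ) := by exact_mod_cast hD b
  have h3 := p.half_log_sub_posLog_le hρ1 hρ2 hρ3 ht (b := b) (by simp at hb; exact hb.2)
  have h4 := p.log_sub_le_logCounting_divisor_eval_sub hp b (by linarith : 0 < r)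
  have h5 : ρ + ‖p.eval 0‖ = ‖p.leadingCoeff‖ * r ^ p.natDegree := by rw [hρdef]; ring
  rw [h5] at h3
  nlinarith [mul_le_mul_of_nonneg_left (h3.trans h4) hb']

/-- `T(ρ, f) ≤ 2 * T(r, f ∘ p) + O(1)` for `ρ = ‖lc p‖ * r ^ n - ‖p 0‖`. By Cartan's formula the
characteristic is, up to a constant, the mean over `‖a‖ = 1` of the counting functions of the
`a`-points, to which `logCounting_le_two_mul_logCounting_comp` applies. -/
theorem characteristic_le_two_mul_characteristic_comp {p : ℂ[X]} (hp : 1 ≤ p.natDegree)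
    {f : ℂ → ℂ} (hf : Meromorphic f) :
    ∃ ρ₀ C : ℝ, 1 ≤ ρ₀ ∧ 0 ≤ C ∧ ∀ r : ℝ, 1 ≤ r →
      ρ₀ ≤ ‖p.leadingCoeff‖ * r ^ p.natDegree - ‖p.eval 0‖ →
      characteristic f ⊤ (‖p.leadingCoeff‖ * r ^ p.natDegree - ‖p.eval 0‖) ≤
        2 * characteristic (fun z ↦ f (p.eval z)) ⊤ r + C := by
  obtain ⟨ρ₀, hρ₀, h⟩ := logCounting_le_two_mul_logCounting_comp hp
  obtain ⟨c₁, hc₁⟩ := characteristic_top_eq_circleAverage_add_const hf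
  obtain ⟨c₂, hc₂⟩ := characteristic_top_eq_circleAverage_add_const (hf.comp_eval p)
  refine ⟨ρ₀, |c₁ + (characteristic f ⊤ 1 - c₁) - 2 * c₂|, hρ₀, abs_nonneg _, fun r hr hρ ↦ ?_⟩
  set ρ := ‖p.leadingCoeff‖ * r ^ p.natDegree - ‖p.eval 0‖ with hρdef
  have hi₁ := circleIntegrable_logCounting hf (R := ρ)
  have hi₂ := circleIntegrable_logCounting hf (R := 1)
  have hi₃ := circleIntegrable_logCounting (hf.comp_eval p) (R := r)
  have hav : Real.circleAverage (fun a : ℂ ↦ logCounting f a ρ - logCounting f a 1) 0 1 ≤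
      Real.circleAverage (fun a : ℂ ↦ 2 * logCounting (fun z ↦ f (p.eval z)) a r) 0 1 := by
    refine Real.circleAverage_mono (hi₁.sub hi₂) (hi₃.const_mul 2) fun a _ ↦ ?_
    simp only [logCounting_coe_eq_logCounting_sub_const_zero]
    exact h _ (hf.sub (.const a)) r hr hρ
  rw [Real.circleAverage_fun_sub hi₁ hi₂, circleAverage_const_mul] at hav
  have e₁ := hc₁ ρ (by linarith)
  have e₂ := hc₁ 1 one_ne_zero
  have e₃ := hc₂ r (by linarith)
  have := le_abs_self (c₁ + (characteristic f ⊤ 1 - c₁) - 2 * c₂)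
  linarith

/-! ### Growth of the characteristic of a nonconstant function -/

/-- Identity theorem: infinite order at one point forces `g` to vanish off a discrete set. -/
theorem Meromorphic.eventuallyEq_zero_codiscrete {g : ℂ → ℂ} (hg : Meromorphic g) {u : ℂ}
    (hu : meromorphicOrderAt g u = ⊤) : g =ᶠ[codiscrete ℂ] 0 := by
  have hall : ∀ x, meromorphicOrderAt g x = ⊤ := by
    intro x
    by_contra hx
    exact (hg.meromorphicOn (s := univ)).meromorphicOrderAt_ne_top_of_isPreconnected
      isPreconnected_univ (mem_univ x) (mem_univ u) hx hu
  rw [EventuallyEq, Filter.Eventually, codiscrete, mem_codiscreteWithin_iff_forall_mem_nhdsNE]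
  intro x _
  simpa using! meromorphicOrderAt_eq_top_iff.1 (hall x)

open Function in
theorem log_le_logCounting_zero {g : ℂ → ℂ} (hg : Meromorphic g) (h0 : 0 < meromorphicOrderAt g 0)
    (htop : meromorphicOrderAt g 0 ≠ ⊤) {r : ℝ} (hr : 1 ≤ r) :
    Real.log r ≤ logCounting g 0 r := by
  have h1 : 1 ≤ MeromorphicOn.divisor g univ 0 := by
    rw [MeromorphicOn.divisor_apply hg.meromorphicOn (mem_univ _)]
    lift meromorphicOrderAt g 0 to ℤ using htop with m
    have : 0 < m := by exact_mod_cast h0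
    simpa using Int.add_one_le_of_lt this
  have h2 : locallyFinsuppWithin.single (0 : ℂ) (1 : ℤ) ≤ (MeromorphicOn.divisor g univ)⁺ := by
    intro z
    rw [locallyFinsuppWithin.single_apply, locallyFinsuppWithin.posPart_apply]
    split_ifs with hz
    · exact hz ▸ h1.trans (le_posPart _)
    · exact posPart_nonneg _
  have h3 := locallyFinsuppWithin.logCounting_le h2 hr
  rw [locallyFinsuppWithin.logCounting_single_eq_log_sub_const (by simpa using by linarith)] at h3
  simpa [logCounting_zero] using h3

theorem logCounting_le_characteristic {E : Type*} [NormedAddCommGroup E] [NormedSpace ℂ E]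
    (f : ℂ → E) (r : ℝ) : logCounting f ⊤ r ≤ characteristic f ⊤ r := by
  have := proximity_nonneg (f := f) (a := ⊤) r
  simp only [characteristic, Pi.add_apply]
  simpa using this

/-- The characteristic of a nonconstant function is unbounded: `1 / f` or `f - a` for a suitable
`a` has a zero at `0`, and this single zero contributes `log r` to a counting function. -/
theorem tendsto_characteristic_atTop {f : ℂ → ℂ} (hf : Meromorphic f)
    (hnc : ∀ a, meromorphicOrderAt (fun z ↦ f z - a) 0 ≠ ⊤) :
    Tendsto (characteristic f ⊤) atTop atTop := by
  suffices h : ∃ C, ∀ r, 1 ≤ r → Real.log r - C ≤ characteristic f ⊤ r by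
    obtain ⟨C, hC⟩ := h
    refine tendsto_atTop_mono' _ ?_ (tendsto_atTop_add_const_right _ (-C) Real.tendsto_log_atTop)
    filter_upwards [eventually_ge_atTop 1] with r hr using by simpa [sub_eq_add_neg] using hC r hr
  rcases lt_or_ge (meromorphicOrderAt f 0) 0 with hneg | hnn
  · refine ⟨0, fun r hr ↦ ?_⟩
    have h1 : meromorphicOrderAt f⁻¹ 0 = -meromorphicOrderAt f 0 := meromorphicOrderAt_inv
    have h2 : 0 < meromorphicOrderAt f⁻¹ 0 ∧ meromorphicOrderAt f⁻¹ 0 ≠ ⊤ := by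
      rw [h1]
      lift meromorphicOrderAt f 0 to ℤ using hneg.ne_top with m
      have : m < 0 := by exact_mod_cast hneg
      have h3 : -(m : WithTop ℤ) = ((-m : ℤ) : WithTop ℤ) := rfl
      rw [h3]
      exact ⟨by exact_mod_cast neg_pos.2 this, WithTop.coe_ne_top⟩
    have h3 := log_le_logCounting_zero hf.inv h2.1 h2.2 hr
    rw [← logCounting_inv, inv_inv] at h3
    simpa using h3.trans (logCounting_le_characteristic f r)
  · obtain ⟨a, ha⟩ := tendsto_nhds_of_meromorphicOrderAt_nonneg (hf 0) hnn
    have hg : Meromorphic fun z ↦ f z - a := hf.sub (.const a)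
    have h0 : 0 < meromorphicOrderAt (fun z ↦ f z - a) 0 := by
      rw [← tendsto_zero_iff_meromorphicOrderAt_pos (hg 0)]
      simpa using ha.sub_const a
    refine ⟨max |Real.log ‖(fun z ↦ f z - a) 0‖|
      |Real.log ‖meromorphicTrailingCoeffAt (fun z ↦ f z - a) 0‖| +
        (Real.posLog ‖a‖ + Real.log 2), fun r hr ↦ ?_⟩
    have h1 := log_le_logCounting_zero hg h0 (hnc a) hr
    have h2 := logCounting_le_characteristic (fun z ↦ f z - a)⁻¹ r
    rw [logCounting_inv] at h2
    have h3 := abs_le.1 (characteristic_sub_characteristic_inv_le hg (R := r))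
    have h4 := abs_le.1 (abs_characteristic_sub_characteristic_shift_le hf (a₀ := a) (r := r))
    linarith [h3.1, h4.1]

/-! ### The algebraic core of the second main theorem -/

/-- A point `x` is within half the minimal distance `δ` of the `a k` of at most one `a k`, so that
at most one summand exceeds a constant. The inequality also holds at `x = a k`, where
`1 / (x - a k)` is `0` by convention. -/
theorem exists_sum_posLog_inv_sub_le {q : ℕ} {a : Fin q → ℂ} (ha : Function.Injective a) :
    ∃ C : ℝ, ∀ x : ℂ, ∑ k, Real.posLog ‖1 / (x - a k)‖ ≤
      Real.posLog ‖∑ k, 1 / (x - a k)‖ + C := by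
  obtain ⟨δ, hδ, hδa⟩ : ∃ δ : ℝ, 0 < δ ∧ ∀ i j, i ≠ j → δ ≤ ‖a i - a j‖ := by
    have hfin : ∀ᶠ δ : ℝ in nhdsWithin 0 (Ioi 0), ∀ i j, i ≠ j → δ ≤ ‖a i - a j‖ := by
      simp only [eventually_all]
      intro i j hij
      have : 0 < ‖a i - a j‖ := norm_pos_iff.2 (sub_ne_zero.2 (ha.ne hij))
      filter_upwards [Ioo_mem_nhdsGT this] with δ hδ using hδ.2.le
    obtain ⟨δ, h1, h2⟩ := (hfin.and self_mem_nhdsWithin).exists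
    exact ⟨δ, h2, h1⟩
  have hfar : ∀ x k, δ / 2 ≤ ‖x - a k‖ → ‖1 / (x - a k)‖ ≤ 2 / δ := by
    intro x k h
    rw [norm_div, norm_one]
    calc 1 / ‖x - a k‖ ≤ 1 / (δ / 2) := by gcongr
      _ = 2 / δ := by field_simp
  set L := Real.posLog (2 / δ) with hL
  have hL0 : 0 ≤ L := Real.posLog_nonneg
  have hfar' : ∀ x k, δ / 2 ≤ ‖x - a k‖ → Real.posLog ‖1 / (x - a k)‖ ≤ L := fun x k h ↦
    Real.posLog_le_posLog (norm_nonneg _) (hfar x k h)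
  refine ⟨q * L + (Real.posLog (q * (2 / δ)) + Real.log 2), fun x ↦ ?_⟩
  have hlog2 : 0 ≤ Real.log 2 := Real.log_nonneg one_le_two
  by_cases hx : ∃ k, ‖x - a k‖ < δ / 2
  · obtain ⟨k, hk⟩ := hx
    have hj : ∀ j ∈ Finset.univ.erase k, δ / 2 ≤ ‖x - a j‖ := by
      intro j hj
      have h1 := hδa j k (Finset.ne_of_mem_erase hj)
      have h2 : ‖a j - a k‖ ≤ ‖x - a j‖ + ‖x - a k‖ := by
        rw [← norm_neg (x - a j)]
        refine le_trans (le_of_eq ?_) (norm_add_le _ _)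
        congr 1; ring
      linarith
    have hcard : ((Finset.univ.erase k).card : ℝ) ≤ q := by
      exact_mod_cast (Finset.card_le_univ _).trans (by simp)
    have hmain : Real.posLog ‖1 / (x - a k)‖ ≤ Real.posLog ‖∑ k, 1 / (x - a k)‖ +
        Real.posLog (q * (2 / δ)) + Real.log 2 := by
      have e : 1 / (x - a k) = (∑ k, 1 / (x - a k)) +
          -∑ j ∈ Finset.univ.erase k, 1 / (x - a j) := by
        rw [← Finset.add_sum_erase _ _ (Finset.mem_univ k)]
        ring
      rw [e]
      have h1 := Real.posLog_norm_add_le (∑ k, 1 / (x - a k))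
        (-∑ j ∈ Finset.univ.erase k, 1 / (x - a j))
      have h2 : Real.posLog ‖-∑ j ∈ Finset.univ.erase k, 1 / (x - a j)‖ ≤
          Real.posLog (q * (2 / δ)) := by
        refine Real.posLog_le_posLog (norm_nonneg _) ?_
        rw [norm_neg]
        refine (norm_sum_le_of_le _ fun j h ↦ hfar x j (hj j h)).trans ?_
        rw [Finset.sum_const, nsmul_eq_mul]
        gcongr
      linarith
    rw [← Finset.add_sum_erase _ _ (Finset.mem_univ k)]
    have h3 : ∑ j ∈ Finset.univ.erase k, Real.posLog ‖1 / (x - a j)‖ ≤ q * L := by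
      refine (Finset.sum_le_sum fun j h ↦ hfar' x j (hj j h)).trans ?_
      rw [Finset.sum_const, nsmul_eq_mul]
      gcongr
    linarith
  · push Not at hx
    have h3 : ∑ k, Real.posLog ‖1 / (x - a k)‖ ≤ q * L := by
      refine (Finset.sum_le_sum fun j _ ↦ hfar' x j (hx j)).trans ?_
      simp
    have h4 := Real.posLog_nonneg (x := ‖∑ k, 1 / (x - a k)‖)
    have h5 := Real.posLog_nonneg (x := q * (2 / δ))
    linarith

theorem posLog_norm_sub_div_le (x y b : ℂ) :
    Real.posLog ‖(y - x) / (x - b)‖ ≤ Real.posLog ‖(y - b) / (x - b)‖ + Real.log 2 := by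
  rcases eq_or_ne (x - b) 0 with h | h
  · simp [h, Real.log_nonneg one_le_two]
  · have e : (y - x) / (x - b) = (y - b) / (x - b) + -1 := by field_simp; ring
    rw [e]
    simpa using Real.posLog_norm_add_le ((y - b) / (x - b)) (-1)

/-- Pointwise form of the main inequality, with `x = f (φ z)` and `y = f (ω z)`. -/
theorem exists_sum_posLog_inv_sub_le_posLog_inv_sub {q : ℕ} {a : Fin q → ℂ}
    (ha : Function.Injective a) :
    ∃ C : ℝ, ∀ x y : ℂ, y - x ≠ 0 → ∑ k, Real.posLog ‖1 / (x - a k)‖ ≤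
      Real.posLog ‖1 / (y - x)‖ + ∑ k, Real.posLog ‖(y - a k) / (x - a k)‖ + C := by
  obtain ⟨C, hC⟩ := exists_sum_posLog_inv_sub_le ha
  refine ⟨q * Real.log 2 + Real.log q + C, fun x y hxy ↦ (hC x).trans ?_⟩
  have e : ∑ k, 1 / (x - a k) = 1 / (y - x) * ∑ k, (y - x) / (x - a k) := by
    rw [Finset.mul_sum]
    refine Finset.sum_congr rfl fun k _ ↦ ?_
    rw [one_div_mul_eq_div, div_right_comm, div_self hxy]
  have h1 : Real.posLog ‖∑ k, 1 / (x - a k)‖ ≤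
      Real.posLog ‖1 / (y - x)‖ + Real.posLog ‖∑ k, (y - x) / (x - a k)‖ := by
    rw [e, norm_mul]; exact Real.posLog_mul
  have h2 : Real.posLog ‖∑ k, (y - x) / (x - a k)‖ ≤
      ∑ k, Real.posLog ‖(y - x) / (x - a k)‖ + Real.log q := by
    simpa [add_comm] using Real.posLog_norm_sum_le Finset.univ fun k ↦ (y - x) / (x - a k)
  have h3 := Finset.sum_le_sum fun k (_ : k ∈ Finset.univ) ↦ posLog_norm_sub_div_le x y (a k)
  simp only [Finset.sum_add_distrib, Finset.sum_const, Finset.card_univ, Fintype.card_fin,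
    nsmul_eq_mul] at h3
  linarith

theorem circleAverage_le_add_add_const {u v w : ℂ → ℝ} {R C : ℝ} (hR : R ≠ 0)
    (hu : CircleIntegrable u 0 R) (hv : CircleIntegrable v 0 R) (hw : CircleIntegrable w 0 R)
    (h : ∀ᶠ z in codiscrete ℂ, u z ≤ v z + w z + C) :
    Real.circleAverage u 0 R ≤ Real.circleAverage v 0 R + Real.circleAverage w 0 R + C := by
  have hvw : CircleIntegrable (fun z ↦ v z + w z) 0 R := hv.add hw
  have hc : CircleIntegrable (fun _ ↦ C) 0 R := circleIntegrable_const _ _ _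
  rw [← Real.circleAverage_fun_add hv hw, ← Real.circleAverage_const C 0 R,
    ← Real.circleAverage_fun_add hvw hc]
  exact circleAverage_mono_codiscrete hR hu (hvw.add hc) h

/-- The second main theorem for a pair of functions `F` and `G`, with the proximity functions of
`(G - b) / (F - b)` as error terms. -/
theorem exists_proximity_add_sum_proximity_le {F G : ℂ → ℂ} (hF : Meromorphic F)
    (hG : Meromorphic G) (hF0 : ∀ u, meromorphicOrderAt F u ≠ ⊤)
    (hΔ : ∀ u, meromorphicOrderAt (fun z ↦ G z - F z) u ≠ ⊤)
    {q : ℕ} {a : Fin q → ℂ} (ha : Function.Injective a) :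
    ∃ C : ℝ, ∀ r, 0 < r →
      proximity F ⊤ r + ∑ k, proximity (fun z ↦ 1 / (F z - a k)) ⊤ r ≤
        2 * characteristic F ⊤ r - (2 * logCounting F ⊤ r - logCounting (fun z ↦ G z - F z) ⊤ r
          + logCounting (fun z ↦ 1 / (G z - F z)) ⊤ r)
        + proximity (fun z ↦ G z / F z) ⊤ r
        + ∑ k, proximity (fun z ↦ (G z - a k) / (F z - a k)) ⊤ r + C := by
  obtain ⟨C, hC⟩ := exists_sum_posLog_inv_sub_le_posLog_inv_sub ha
  have hD : Meromorphic fun z ↦ G z - F z := hG.sub hF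
  have hDi : Meromorphic fun z ↦ 1 / (G z - F z) := (Meromorphic.const 1).div hD
  have hGF : Meromorphic fun z ↦ G z / F z := hG.div hF
  have hFa : ∀ k, Meromorphic fun z ↦ 1 / (F z - a k) := fun k ↦
    (Meromorphic.const 1).div (hF.sub (.const _))
  have hGFa : ∀ k, Meromorphic fun z ↦ (G z - a k) / (F z - a k) := fun k ↦
    (hG.sub (.const _)).div (hF.sub (.const _))
  have hD0 := hD.codiscrete_setOf_analyticAt_and_ne_zero hΔ
  have hF0' := hF.codiscrete_setOf_analyticAt_and_ne_zero hF0
  refine ⟨C + Real.log 2 + max |Real.log ‖(fun z ↦ G z - F z) 0‖|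
    |Real.log ‖meromorphicTrailingCoeffAt (fun z ↦ G z - F z) 0‖|, fun r hr ↦ ?_⟩
  have hi : ∀ {h : ℂ → ℂ}, Meromorphic h → CircleIntegrable (fun z ↦ Real.posLog ‖h z‖) 0 r :=
    fun hh ↦ hh.meromorphicOn.circleIntegrable_posLog_norm
  have h1 : ∑ k, proximity (fun z ↦ 1 / (F z - a k)) ⊤ r ≤
      proximity (fun z ↦ 1 / (G z - F z)) ⊤ r
        + ∑ k, proximity (fun z ↦ (G z - a k) / (F z - a k)) ⊤ r + C := by
    simp only [proximity_top]
    rw [← Real.circleAverage_fun_sum fun k _ ↦ hi (hFa k),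
      ← Real.circleAverage_fun_sum fun k _ ↦ hi (hGFa k)]
    refine circleAverage_le_add_add_const hr.ne' (CircleIntegrable.fun_sum _ fun k _ ↦ hi (hFa k))
      (hi hDi) (CircleIntegrable.fun_sum _ fun k _ ↦ hi (hGFa k)) ?_
    filter_upwards [hD0] with z hz using hC (F z) (G z) hz.2
  have h2 : proximity (fun z ↦ G z - F z) ⊤ r ≤
      proximity F ⊤ r + proximity (fun z ↦ G z / F z) ⊤ r + Real.log 2 := by
    simp only [proximity_top]
    refine circleAverage_le_add_add_const hr.ne' (hi hD) (hi hF) (hi hGF) ?_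
    filter_upwards [hF0'] with z hz
    have e : G z - F z = F z * ((G z - F z) / (F z - 0)) := by
      have := hz.2
      rw [sub_zero]; field_simp
    have h3 := posLog_norm_sub_div_le (F z) (G z) 0
    rw [sub_zero, sub_zero] at h3
    rw [sub_zero] at e
    calc Real.posLog ‖G z - F z‖ = Real.posLog (‖F z‖ * ‖(G z - F z) / F z‖) := by
          rw [← norm_mul, ← e]
      _ ≤ _ := Real.posLog_mul
      _ ≤ _ := by linarith
  have h3 := (abs_le.1 (characteristic_sub_characteristic_inv_le hD (R := r))).1
  have h4 : (fun z ↦ G z - F z)⁻¹ = fun z ↦ 1 / (G z - F z) := by ext z; simp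
  rw [h4] at h3
  simp only [characteristic, Pi.add_apply] at h3 ⊢
  linarith

/-! ### The difference estimate in terms of the characteristic -/

theorem proximity_le_characteristic (f : ℂ → ℂ) {r : ℝ} (hr : 1 ≤ r) :
    proximity f ⊤ r ≤ characteristic f ⊤ r := by
  have := logCounting_nonneg (f := f) (e := ⊤) hr
  simp only [characteristic, Pi.add_apply]
  linarith

/-- `proximity_comp_div_comp_le` with the choices `s = K * r ^ (n - 1)`,
`d = η = ‖c‖ * r ^ (n - μ) / 4` and `R = ‖c‖ * r ^ n + 2 * η`. The proximity functions and the
number of zeros and poles are bounded by the characteristic at the larger radius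
`‖c‖ * (r + r ^ (1 - μ)) ^ n - ‖φ 0‖ ≥ R + η`. The constants do not depend on `g`. -/
theorem exists_proximity_comp_div_comp_le {n : ℕ} (hn : 1 ≤ n) {c : ℂ} {ω φ : ℂ[X]}
    (hω : ω.natDegree = n) (hωc : ω.leadingCoeff = c)
    (hφ : φ.natDegree = n) (hφc : φ.leadingCoeff = c)
    {μ α : ℝ} (hμ : 0 < μ) (hμα : μ < α) (hα : n * α < 1) :
    ∃ C r₀ : ℝ, 0 ≤ C ∧ 1 ≤ r₀ ∧ ∀ r, r₀ ≤ r → ∀ g : ℂ → ℂ, Meromorphic g →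
      (∀ u, meromorphicOrderAt g u ≠ ⊤) →
      proximity (fun z ↦ g (ω.eval z) / g (φ.eval z)) ⊤ r ≤ C * r ^ (μ - α) *
        (characteristic g ⊤ (‖c‖ * (r + r ^ (1 - μ)) ^ n - ‖φ.eval 0‖) +
          characteristic g⁻¹ ⊤ (‖c‖ * (r + r ^ (1 - μ)) ^ n - ‖φ.eval 0‖)) := by
  have hα0 : 0 < α := hμ.trans hμα
  have hα1 : α < 1 := by
    have : (1 : ℝ) ≤ n := by exact_mod_cast hn
    nlinarith
  set A := ‖c‖ with hAdef
  have hA : 0 < A := by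
    rw [hAdef, norm_pos_iff, ← hφc, Ne, leadingCoeff_eq_zero]
    rintro rfl
    simp at hφ; lia
  set K₀ := ‖φ.eval 0‖ with hK₀def
  have hK₀ : 0 ≤ K₀ := norm_nonneg _
  obtain ⟨K, hK, hωφ⟩ := (ω - φ).exists_norm_eval_le
    (natDegree_sub_le_sub_one hn hω hφ (hωc.trans hφc.symm))
  obtain ⟨K₁, hK₁, hφK⟩ := (φ - C c * X ^ n).exists_norm_eval_le
    (natDegree_sub_le_sub_one hn hφ (natDegree_C_mul_X_pow n c (norm_pos_iff.1 hA))
      (by rw [hφc, leadingCoeff_C_mul_X_pow]))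
  obtain ⟨M₁, hM₁, hωM⟩ := ω.circleAverage_norm_eval_sub_rpow_neg_le (by lia) hα0 (by rwa [hω])
  obtain ⟨M₂, hM₂, hφM⟩ := φ.circleAverage_norm_eval_sub_rpow_neg_le (by lia) hα0 (by rwa [hφ])
  set M := max M₁ M₂ with hM
  have hM0 : 0 ≤ M := hM₁.trans (le_max_left _ _)
  set B := 32 * K ^ α * M / α with hB
  have hB0 : 0 ≤ B := by positivity
  obtain ⟨r₀, hr₀⟩ := eventually_atTop.1
    ((tendsto_rpow_atTop (by linarith : 0 < 1 - μ)).eventually_ge_atTop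
      (max 1 (max (4 * K₁ / A) (max (8 * K / A) (4 * K₀ / A)))))
  refine ⟨32 * K / A + B, max (max 1 r₀) (max (3 * K₀ / A) (1 / A)), by positivity,
    (le_max_left _ _).trans (le_max_left _ _), fun r hr g hg hg' ↦ ?_⟩
  simp only [max_le_iff] at hr
  obtain ⟨⟨hr1, hr2⟩, hr3, hr4⟩ := hr
  have hr0 : 0 < r := by linarith
  have hh := hr₀ r hr2
  set h := r ^ (1 - μ) with hhdef
  simp only [max_le_iff] at hh
  obtain ⟨hh1, hh2, hh3, hh4⟩ := hh
  obtain ⟨m, rfl⟩ : ∃ m, n = m + 1 := ⟨n - 1, by lia⟩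
  rw [add_tsub_cancel_right] at hωφ hφK
  have hrm : (1 : ℝ) ≤ r ^ m := one_le_pow₀ hr1
  set η := A * (r ^ m * h) / 4 with hηdef
  have hη : 0 < η := by positivity
  have hhr : h ≤ r := by
    calc h ≤ r ^ (1 : ℝ) := Real.rpow_le_rpow_of_exponent_le hr1 (by linarith)
      _ = r := Real.rpow_one r
  have hηA : η ≤ A * r ^ (m + 1) / 4 := by
    rw [hηdef, pow_succ]
    gcongr
  have hKη : 2 * (K * r ^ m) ≤ η := by
    rw [div_le_iff₀ hA] at hh3
    rw [hηdef]
    nlinarith [mul_le_mul_of_nonneg_left hh3 (by positivity : 0 ≤ r ^ m)]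
  have hK₁η : K₁ * r ^ m ≤ η := by
    rw [div_le_iff₀ hA] at hh2
    rw [hηdef]
    nlinarith [mul_le_mul_of_nonneg_left hh2 (by positivity : 0 ≤ r ^ m)]
  have hK₀η : K₀ ≤ η := by
    rw [div_le_iff₀ hA] at hh4
    rw [hηdef]
    nlinarith [mul_le_mul_of_nonneg_left hh4 (by positivity : 0 ≤ r ^ m)]
  set R := A * r ^ (m + 1) + 2 * η with hRdef
  set R' := A * (r + h) ^ (m + 1) - K₀ with hR'def
  have hRR' : R + η ≤ R' := by
    have h1 : r ^ m * (r + h) ≤ (r + h) ^ (m + 1) := by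
      rw [pow_succ]
      gcongr
      linarith
    have h2 := mul_le_mul_of_nonneg_left h1 hA.le
    have h3 : A * (r ^ m * (r + h)) = A * r ^ (m + 1) + 4 * η := by
      rw [hηdef, pow_succ]; ring
    rw [hR'def, hRdef]
    linarith
  have hrn : r ≤ r ^ (m + 1) := le_self_pow₀ hr1 (by lia)
  have hArn : A * r ≤ A * r ^ (m + 1) := by gcongr
  have hR1 : 1 ≤ R := by
    rw [div_le_iff₀ hA] at hr4
    rw [hRdef]
    linarith
  have hRlt : R < R' := by linarith
  have hfin : (MeromorphicOn.divisor g (Metric.ball 0 R)).support.Finite :=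
    MeromorphicOn.divisor_ball_support_finite hg.meromorphicOn
  have hT := hfin.coe_toFinset.symm
  set T := hfin.toFinset
  set N := ∑ i ∈ T, |(MeromorphicOn.divisor g (Metric.ball 0 R) i : ℝ)| with hNdef
  set W := characteristic g ⊤ R' + characteristic g⁻¹ ⊤ R' with hW
  have hprox : proximity g ⊤ R + proximity g⁻¹ ⊤ R ≤ W := by
    have h1 := characteristic_monotoneOn hg (by simp; linarith) (by simp; linarith) hRlt.le
    have h2 := characteristic_monotoneOn hg.inv (by simp; linarith) (by simp; linarith) hRlt.le
    have h3 := proximity_le_characteristic g hR1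
    have h4 := proximity_le_characteristic g⁻¹ hR1
    rw [hW]
    linarith
  have hW0 : 0 ≤ W := add_nonneg (characteristic_nonneg (by linarith))
    (characteristic_nonneg (by linarith))
  have hh0 : 0 < h := by linarith
  have hN : N ≤ 8 * r ^ μ * W := by
    have h1 := sum_abs_divisor_mul_log_le hg hR1 hRlt hT
    have h2 := logCounting_le_characteristic g R'
    have h3 := logCounting_le_characteristic g⁻¹ R'
    rw [logCounting_inv] at h3
    have h4 : h / (8 * r) ≤ Real.log (R' / R) := by
      have hRp : 0 < R := by linarith
      calc h / (8 * r) = η / (2 * (A * r ^ (m + 1))) := by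
            rw [hηdef, pow_succ]; field_simp; norm_num
        _ ≤ η / (R + η) := by gcongr; rw [hRdef]; linarith
        _ = 1 - ((R + η) / R)⁻¹ := by field_simp; ring
        _ ≤ Real.log ((R + η) / R) := Real.one_sub_inv_le_log_of_pos (by positivity)
        _ ≤ _ := by gcongr
    have hN0 : 0 ≤ N := Finset.sum_nonneg fun _ _ ↦ abs_nonneg _
    have h5 : N * (h / (8 * r)) ≤ W := by
      have := mul_le_mul_of_nonneg_left h4 hN0
      rw [hW]
      linarith
    have h6 : r ^ μ * h = r := by
      rw [hhdef, ← Real.rpow_add hr0, add_sub_cancel, Real.rpow_one]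
    calc N = 8 * r ^ μ * (N * (h / (8 * r))) := by
          rw [show 8 * r ^ μ * (N * (h / (8 * r))) = N * (r ^ μ * h) / r by field_simp, h6]
          field_simp
      _ ≤ _ := by gcongr
  have hMr : ∀ {M'}, M' ≤ M → M' * r ^ (-(((m + 1 : ℕ) : ℝ) * α)) ≤
      M * r ^ (-(((m + 1 : ℕ) : ℝ) * α)) := fun h ↦ by gcongr
  have hmain := proximity_comp_div_comp_le hg hg' (ω := ω) (φ := φ) (by lia) (by lia)
    (R := R) (d := η) (s := K * r ^ m) (α := α) (M := M * r ^ (-(((m + 1 : ℕ) : ℝ) * α)))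
    hr0 hη hα0 hα1.le ?_ ?_ hKη ?_
    (fun b ↦ ⟨(hωM b r hr0).1, (hω ▸ (hωM b r hr0).2).trans (hMr (le_max_left _ _))⟩)
    (fun b ↦ ⟨(hφM b r hr0).1, (hφ ▸ (hφM b r hr0).2).trans (hMr (le_max_right _ _))⟩) hT
  · have e1 : 8 * (K * r ^ m) / η ≤ 32 * K / A * r ^ (μ - α) := by
      have : h⁻¹ ≤ r ^ (μ - α) := by
        rw [hhdef, ← Real.rpow_neg hr0.le]
        exact Real.rpow_le_rpow_of_exponent_le hr1 (by linarith)
      calc 8 * (K * r ^ m) / η = 32 * K / A * h⁻¹ := by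
            rw [hηdef]; field_simp; ring
        _ ≤ _ := by gcongr
    have e2 : 4 * ((K * r ^ m) ^ α / α) * (M * r ^ (-(((m + 1 : ℕ) : ℝ) * α))) * (8 * r ^ μ * W) =
        B * r ^ (μ - α) * W := by
      have e3 : (r ^ m) ^ α * r ^ (-(((m + 1 : ℕ) : ℝ) * α)) * r ^ μ = r ^ (μ - α) := by
        rw [← Real.rpow_natCast r m, ← Real.rpow_mul hr0.le, ← Real.rpow_add hr0,
          ← Real.rpow_add hr0]
        congr 1
        push_cast
        ring
      rw [Real.mul_rpow hK (by positivity), ← e3, hB]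
      ring
    calc _ ≤ _ := hmain
      _ ≤ 32 * K / A * r ^ (μ - α) * W +
          4 * ((K * r ^ m) ^ α / α) * (M * r ^ (-(((m + 1 : ℕ) : ℝ) * α))) *
            (8 * r ^ μ * W) := by
        gcongr
        exact add_nonneg (proximity_nonneg _) (proximity_nonneg _)
      _ = _ := by rw [e2]; ring
  · intro z hz
    have h1 := hφK r hr1 z hz
    have h2 : φ.eval z = (φ - C c * X ^ (m + 1)).eval z + c * z ^ (m + 1) := by simp
    have h3 : ‖c * z ^ (m + 1)‖ ≤ A * r ^ (m + 1) := by
      rw [norm_mul, norm_pow]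
      gcongr
    rw [h2]
    have h4 := norm_add_le ((φ - C c * X ^ (m + 1)).eval z) (c * z ^ (m + 1))
    rw [hRdef]
    linarith
  · intro z hz
    rw [← eval_sub]
    exact hωφ r hr1 z hz.le
  · rw [div_le_iff₀ hA] at hr3
    rw [hRdef]
    linarith

/-! ### Hyper-order and the exceptional set -/

theorem exists_log_characteristic_le_rpow {f : ℂ → ℂ}
    (hT : Tendsto (characteristic f ⊤) atTop atTop) {b : ℝ} (hb : 0 < b)
    (hord : hyperOrder f < (b : EReal)) :
    ∃ l x₀ : ℝ, 0 < l ∧ l < b ∧ ∀ x, x₀ ≤ x →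
      1 ≤ characteristic f ⊤ x ∧ Real.log (characteristic f ⊤ x) ≤ x ^ l := by
  obtain ⟨l, hl1, hl2⟩ := EReal.lt_iff_exists_real_btwn.1
    (max_lt hord (EReal.coe_pos.2 hb : (0 : EReal) < b))
  rw [max_lt_iff] at hl1
  have hl0 : 0 < l := by exact_mod_cast hl1.2
  refine ⟨l, ?_⟩
  obtain ⟨x₀, hx₀⟩ := eventually_atTop.1 ((eventually_lt_of_limsup_lt hl1.1).and
    ((hT.eventually_ge_atTop (Real.exp 1)).and (eventually_gt_atTop 1)))
  refine ⟨x₀, hl0, by exact_mod_cast hl2, fun x hx ↦ ?_⟩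
  obtain ⟨h1, h2, h3⟩ := hx₀ x hx
  have h1' : Real.log (Real.log (characteristic f ⊤ x)) / Real.log x < l := by exact_mod_cast h1
  have hlogx : 0 < Real.log x := Real.log_pos h3
  have hTpos : 0 < characteristic f ⊤ x := (Real.exp_pos 1).trans_le h2
  have hlogT : 1 ≤ Real.log (characteristic f ⊤ x) := (Real.le_log_iff_exp_le hTpos).2 h2
  refine ⟨(Real.one_le_exp zero_le_one).trans h2, ?_⟩
  rw [div_lt_iff₀ hlogx] at h1'
  rw [← Real.log_le_log_iff (by linarith) (by positivity), Real.log_rpow (by linarith)]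
  exact h1'.le

theorem tendsto_characteristic_comp_eval_atTop {f : ℂ → ℂ} (hf : Meromorphic f)
    (hT : Tendsto (characteristic f ⊤) atTop atTop) {p : ℂ[X]} (hp : 1 ≤ p.natDegree) :
    Tendsto (characteristic (fun z ↦ f (p.eval z)) ⊤) atTop atTop := by
  obtain ⟨ρ₀, C, hρ₀, hC, hcomp⟩ := characteristic_le_two_mul_characteristic_comp hp hf
  have hA : 0 < ‖p.leadingCoeff‖ := by
    rw [norm_pos_iff, Ne, leadingCoeff_eq_zero]
    rintro rfl
    simp at hp
  have hρ : Tendsto (fun r : ℝ ↦ ‖p.leadingCoeff‖ * r ^ p.natDegree - ‖p.eval 0‖) atTop atTop :=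
    tendsto_atTop_add_const_right _ _ ((tendsto_pow_atTop (by lia)).const_mul_atTop hA)
  refine tendsto_atTop_mono' _ ?_
    ((tendsto_atTop_add_const_right _ (-C) (hT.comp hρ)).atTop_div_const two_pos)
  filter_upwards [eventually_ge_atTop 1, hρ.eventually_ge_atTop ρ₀] with r hr1 hr2
  have := hcomp r hr1 hr2
  simp only [Function.comp_apply]
  linarith

/-- Outside a set of finite logarithmic measure, the characteristic of `f` at the radius needed
for the difference estimate is bounded by the characteristic of the composition. The factor `4` is
`2` from the growth lemma times `2` from `characteristic_le_two_mul_characteristic_comp`. -/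
theorem exists_characteristic_add_rpow_le {f : ℂ → ℂ} (hf : Meromorphic f)
    {p : ℂ[X]} (hp : 1 ≤ p.natDegree) {l x₀ μ : ℝ} (hl : 0 < l)
    (hlog : ∀ x, x₀ ≤ x → 1 ≤ characteristic f ⊤ x ∧ Real.log (characteristic f ⊤ x) ≤ x ^ l)
    (hlμ : p.natDegree * l < μ) (hμ : μ < 1) :
    ∃ (E : Set ℝ) (C : ℝ), HasFiniteLogMeasure E ∧ 0 ≤ C ∧ ∀ r, r ∉ E →
      characteristic f ⊤ (‖p.leadingCoeff‖ * (r + r ^ (1 - μ)) ^ p.natDegree - ‖p.eval 0‖) ≤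
        4 * characteristic (fun z ↦ f (p.eval z)) ⊤ r + C := by
  set n := p.natDegree with hn
  set A := ‖p.leadingCoeff‖ with hA
  have hA0 : 0 < A := by
    rw [hA, norm_pos_iff, Ne, leadingCoeff_eq_zero]
    rintro rfl
    simp at hn; lia
  set K₀ := ‖p.eval 0‖ with hK₀
  have hK₀0 : 0 ≤ K₀ := norm_nonneg _
  obtain ⟨ρ₀, C, hρ₀, hC, hcomp⟩ := characteristic_le_two_mul_characteristic_comp hp hf
  have hmono : ∀ {x y : ℝ}, 0 ≤ x → x ≤ y → A * x ^ n - K₀ ≤ A * y ^ n - K₀ := fun hx hxy ↦ by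
    gcongr
  obtain ⟨r₀, hr₀1, hr₀⟩ : ∃ r₀ : ℝ, 1 ≤ r₀ ∧ ∀ r, r₀ ≤ r →
      1 ≤ A * r ^ n - K₀ ∧ x₀ ≤ A * r ^ n - K₀ ∧ ρ₀ ≤ A * r ^ n - K₀ := by
    refine ⟨max 1 ((max 1 (max x₀ ρ₀) + K₀) / A), le_max_left _ _, fun r hr ↦ ?_⟩
    rw [max_le_iff, div_le_iff₀ hA0] at hr
    have h1 : r ≤ r ^ n := le_self_pow₀ hr.1 (by lia)
    have h2 : max 1 (max x₀ ρ₀) ≤ A * r ^ n - K₀ := by nlinarith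
    simpa only [max_le_iff] using h2
  -- Replacing `r` by `max r r₀` makes `V` monotone and at least `1` on the whole line.
  set V : ℝ → ℝ := fun r ↦ characteristic f ⊤ (A * max r r₀ ^ n - K₀) with hV
  have hVmono : Monotone V := fun x y hxy ↦ by
    have h1 := (hr₀ _ (le_max_right x r₀)).1
    have h2 := (hr₀ _ (le_max_right y r₀)).1
    refine characteristic_monotoneOn hf (by simp; linarith) (by simp; linarith) (hmono ?_ ?_)
    · exact le_max_of_le_right (by linarith)
    · gcongr
  have hV1 : ∀ r, 1 ≤ V r := fun r ↦ (hlog _ (hr₀ _ (le_max_right r r₀)).2.1).1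
  have hVlog : ∀ r, 1 ≤ r → Real.log (V r) ≤ A ^ l * r₀ ^ (n * l) * r ^ (n * l) := by
    intro r hr
    have h1 := hr₀ _ (le_max_right r r₀)
    have h2 : max r r₀ ≤ r₀ * r := max_le (by nlinarith) (by nlinarith)
    calc Real.log (V r) ≤ (A * max r r₀ ^ n - K₀) ^ l := (hlog _ h1.2.1).2
      _ ≤ (A * (r₀ * r) ^ n) ^ l := by
        refine Real.rpow_le_rpow (by linarith) ?_ hl.le
        have : max r r₀ ^ n ≤ (r₀ * r) ^ n := by gcongr
        nlinarith
      _ = _ := by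
        rw [Real.mul_rpow hA0.le (by positivity), ← Real.rpow_natCast,
          ← Real.rpow_mul (by positivity), Real.mul_rpow (by positivity) (by positivity), mul_assoc]
  refine ⟨_, 2 * C, (hasFiniteLogMeasure_setOf_two_mul_lt hVmono hV1
    (by positivity) hlμ hμ hVlog).union_Iic r₀, by positivity, fun r hr ↦ ?_⟩
  simp only [mem_union, mem_Iic, mem_ofPred_eq, not_or, not_le, not_and, not_lt] at hr
  obtain ⟨hr1, hr2⟩ := hr
  have h1 := hr2 (by linarith)
  have h2 : 0 ≤ r ^ (1 - μ) := Real.rpow_nonneg (by linarith) _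
  simp only [hV] at h1
  rw [max_eq_left hr1.le, max_eq_left (by linarith)] at h1
  have h3 := hcomp r (by linarith) (hr₀ r hr1.le).2.2
  linarith

theorem exists_characteristic_sub_add_characteristic_inv_le {f : ℂ → ℂ} (hf : Meromorphic f)
    (a : ℂ) : ∃ C : ℝ, ∀ x, characteristic (fun z ↦ f z - a) ⊤ x +
      characteristic (fun z ↦ f z - a)⁻¹ ⊤ x ≤ 2 * characteristic f ⊤ x + C := by
  have hg : Meromorphic fun z ↦ f z - a := hf.sub (.const a)
  refine ⟨max |Real.log ‖(fun z ↦ f z - a) 0‖|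
      |Real.log ‖meromorphicTrailingCoeffAt (fun z ↦ f z - a) 0‖| +
        2 * (Real.posLog ‖a‖ + Real.log 2), fun x ↦ ?_⟩
  have h3 := abs_le.1 (characteristic_sub_characteristic_inv_le hg (R := x))
  have h4 := abs_le.1 (abs_characteristic_sub_characteristic_shift_le hf (a₀ := a) (r := x))
  linarith [h3.1, h4.1]

theorem theorem4 (f : ℂ → ℂ) (hf : Meromorphic f)
    (n : ℕ) (hn : 1 ≤ n) (c : ℂ) (ω φ : ℂ[X])
    (hω : ω.natDegree = n) (hωc : ω.leadingCoeff = c)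
    (hφ : φ.natDegree = n) (hφc : φ.leadingCoeff = c)
    (q : ℕ) (hq : 2 ≤ q) (a : Fin q → ℂ) (ha : Function.Injective a)
    (hne : ¬ ((fun z ↦ f (ω.eval z)) =ᶠ[codiscrete ℂ] (fun z ↦ f (φ.eval z))))
    (hord : hyperOrder f < ((1 / (n : ℝ) ^ 2 : ℝ) : EReal)) :
    ∃ (E : Set ℝ) (S : ℝ → ℝ), HasFiniteLogMeasure E ∧
      S =o[atTop ⊓ 𝓟 Eᶜ] characteristic (fun z ↦ f (φ.eval z)) ⊤ ∧
      ∀ r : ℝ, 0 < r → r ∉ E →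
        proximity (fun z ↦ f (φ.eval z)) ⊤ r
            + ∑ k : Fin q, proximity (fun z ↦ 1 / (f (φ.eval z) - a k)) ⊤ r
          ≤ 2 * characteristic (fun z ↦ f (φ.eval z)) ⊤ r
            - compositeCounting f ω φ r + S r := by
  have hn0 : (0 : ℝ) < n := by exact_mod_cast hn
  have hω1 : 1 ≤ ω.natDegree := hω ▸ hn
  have hφ1 : 1 ≤ φ.natDegree := hφ ▸ hn
  have hnc : ∀ b u, meromorphicOrderAt (fun z ↦ f z - b) u ≠ ⊤ := by
    intro b u hu
    have h1 := (hf.sub (.const b)).eventuallyEq_zero_codiscrete hu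
    refine hne ?_
    filter_upwards [preimage_eval_mem_codiscrete hω1 h1, preimage_eval_mem_codiscrete hφ1 h1]
      with z hz1 hz2
    simp only [mem_preimage, Pi.zero_apply, mem_ofPred_eq, Pi.sub_apply, sub_eq_zero] at hz1 hz2
    rw [hz1, hz2]
  have hT := tendsto_characteristic_atTop hf fun b ↦ hnc b 0
  obtain ⟨l, x₀, hl0, hl1, hlog⟩ := exists_log_characteristic_le_rpow hT (by positivity) hord
  have hnl : n * l < 1 / n := by
    rw [lt_div_iff₀ (by positivity)] at hl1 ⊢
    nlinarith
  -- The growth lemma needs `n l < μ`, the difference estimate `μ < α` and `n α < 1`.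
  obtain ⟨μ, hμ1, hμ2⟩ := exists_between hnl
  obtain ⟨α, hα1, hα2⟩ := exists_between hμ2
  have hμ0 : 0 < μ := lt_trans (by positivity) hμ1
  have hnα : n * α < 1 := by rwa [lt_div_iff₀' hn0] at hα2
  have hμlt : μ < 1 := by
    have : (1 : ℝ) ≤ n := by exact_mod_cast hn
    nlinarith
  set F := fun z ↦ f (φ.eval z) with hF
  set G := fun z ↦ f (ω.eval z) with hG
  have hFm : Meromorphic F := hf.comp_eval φ
  have hGm : Meromorphic G := hf.comp_eval ω
  obtain ⟨E₁, C₁, hE₁, hC₁, hgrowth⟩ := exists_characteristic_add_rpow_le hf hφ1 hl0 hlog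
    (by rwa [hφ]) hμlt
  rw [hφ, hφc] at hgrowth
  obtain ⟨C₂, r₂, hC₂, hr₂, hld⟩ :=
    exists_proximity_comp_div_comp_le hn hω hωc hφ hφc hμ0 hα1 hnα
  choose C₃ hC₃ using exists_characteristic_sub_add_characteristic_inv_le hf
  have hTF : Tendsto (characteristic F ⊤) atTop atTop :=
    tendsto_characteristic_comp_eval_atTop hf hT hφ1
  have hF0 : ∀ u, meromorphicOrderAt F u ≠ ⊤ := by
    intro u hu
    obtain ⟨r, hr1, hr0⟩ := ((hTF.eventually_gt_atTop 0).and (eventually_gt_atTop 0)).exists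
    rw [characteristic_congr_codiscrete (hFm.eventuallyEq_zero_codiscrete hu) hr0.ne'] at hr1
    simp [characteristic, proximity_top, Real.circleAverage_const] at hr1
  have hΔ0 : ∀ u, meromorphicOrderAt (fun z ↦ G z - F z) u ≠ ⊤ := by
    intro u hu
    refine hne ?_
    filter_upwards [(hGm.sub hFm).eventuallyEq_zero_codiscrete hu] with z hz
    simpa [sub_eq_zero] using hz
  obtain ⟨C₄, hC₄⟩ := exists_proximity_add_sum_proximity_le hFm hGm hF0 hΔ0 ha
  have hquot : ∀ b r, r ∉ Iic r₂ ∪ E₁ →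
      proximity (fun z ↦ (G z - b) / (F z - b)) ⊤ r ≤
        C₂ * r ^ (μ - α) * (8 * characteristic F ⊤ r + (2 * C₁ + C₃ b)) := by
    intro b r hr
    simp only [mem_union, mem_Iic, not_or, not_le] at hr
    have h1 := hld r hr.1.le _ (hf.sub (.const b)) (hnc b)
    refine h1.trans ?_
    have h2 := hC₃ b (‖c‖ * (r + r ^ (1 - μ)) ^ n - ‖φ.eval 0‖)
    have h3 := hgrowth r hr.2
    have h4 : 0 ≤ r ^ (μ - α) := Real.rpow_nonneg (by linarith) _
    refine mul_le_mul_of_nonneg_left (h2.trans ?_) (by positivity)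
    linarith
  refine ⟨Iic r₂ ∪ E₁, fun r ↦ C₂ * r ^ (μ - α) * (8 * characteristic F ⊤ r + (2 * C₁ + C₃ 0)) +
    ∑ k, C₂ * r ^ (μ - α) * (8 * characteristic F ⊤ r + (2 * C₁ + C₃ (a k))) + C₄,
    hE₁.union_Iic r₂, ?_, fun r hr0 hr ↦ ?_⟩
  · have hr : (fun r : ℝ ↦ r ^ (μ - α)) =o[atTop] fun _ ↦ (1 : ℝ) := by
      rw [isLittleO_one_iff]
      simpa using tendsto_rpow_neg_atTop (sub_pos.2 hα1)
    have hconst : ∀ b : ℝ, (fun _ : ℝ ↦ b) =o[atTop] characteristic F ⊤ := fun b ↦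
      isLittleO_const_left.2 (.inr (tendsto_norm_atTop_atTop.comp hTF))
    have hterm : ∀ b : ℝ, (fun r ↦ C₂ * r ^ (μ - α) * (8 * characteristic F ⊤ r + b))
        =o[atTop] characteristic F ⊤ := fun b ↦ by
      have h1 : (fun r ↦ 8 * characteristic F ⊤ r + b) =O[atTop] characteristic F ⊤ :=
        ((isBigO_refl _ _).const_mul_left 8).add (hconst b).isBigO
      simpa using (hr.const_mul_left C₂).mul_isBigO h1
    exact (((hterm _).add (IsLittleO.fun_sum fun k _ ↦ hterm _)).add (hconst C₄)).mono inf_le_left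
  · have h1 := hC₄ r hr0
    have h2 := hquot 0 r hr
    simp only [sub_zero] at h2
    have h3 := Finset.sum_le_sum fun k (_ : k ∈ Finset.univ) ↦ hquot (a k) r hr
    have h4 : compositeCounting f ω φ r = 2 * logCounting F ⊤ r -
        logCounting (fun z ↦ G z - F z) ⊤ r + logCounting (fun z ↦ 1 / (G z - F z)) ⊤ r := rfl
    rw [h4]
    linarith
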